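/- Let $K$ be a global field (a number field or a finite extension of $\mathbb{F}_p(t)$ for a prime $p$) of characteristic different from $2$, let $w$ be a non-archimedean place of $K$ (an equivalence class of nontrivial non-archimedean absolute values), and let $K_w$ be the completion of $K$ at $w$. For $a,b\in K_w^\times$ let the Hilbert symbol $(a,b)_w$ be $1$ if $z^2=ax^2+by^2$ has a solution $(x,y,z)\neq(0,0,0)$ in $K_w^3$, and $-1$ otherwise. Let $a_1,a_2,a_3,a_4\in K_w^\times$ (for instance, in $K^\times$). Then the quadratic form $a_1x_1^2+a_2x_2^2+a_3x_3^2+a_4x_4^2$ is isotropic over $K_w$, that is, has a zero $(x_1,x_2,x_3,x_4)\neq(0,0,0,0)$ in $K_w^4$, if and only if $$a_1a_2\neq a_3a_4 \ \text{ in } K_w^\times/K_w^{\times 2}\qquad\text{or}\qquad (a_1,a_2)_w\neq-(-a_3,-a_4)_w .$$ -/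

import Mathlib

/-- A global field: a number field, or a global function field, i.e. a finite extension of the
rational function field `𝔽_p(t)` for some prime `p`. (Finite extensions of `𝔽_q(t)` are the same
fields, since `𝔽_q(t)` is finite over `𝔽_p(t)` when `q` is a power of `p`.) -/
def IsGlobalField (K : Type*) [Field K] : Prop :=
  NumberField K ∨
    ∃ (p : ℕ) (_ : Fact p.Prime) (_ : Algebra (RatFunc (ZMod p)) K), FunctionField (ZMod p) K

open Classical in
/-- The Hilbert symbol `(a, b)` of a field `F`: it is `1` if `z² = a x² + b y²` has a solution
`(x, y, z) ≠ (0, 0, 0)` in `F³`, and `-1` otherwise. -/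
noncomputable def hilbertSymbol {F : Type*} [Field F] (a b : Fˣ) : ℤ :=
  if ∃ x y z : F, (x, y, z) ≠ (0, 0, 0) ∧ z ^ 2 = (a : F) * x ^ 2 + (b : F) * y ^ 2 then 1 else -1

/-- The class of `a` in the group `Fˣ / (Fˣ)²` of square classes. -/
def squareClass {F : Type*} [Field F] (a : Fˣ) : Fˣ ⧸ Subgroup.square Fˣ :=
  QuotientGroup.mk a

/-- The diagonal quadratic form `a₁x₁² + a₂x₂² + a₃x₃² + a₄x₄²` over `F`. -/
noncomputable def quaternaryForm {F : Type*} [Field F] (a₁ a₂ a₃ a₄ : Fˣ) :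
    QuadraticForm F (Fin 4 → F) :=
  QuadraticMap.weightedSumSquares F ![(a₁ : F), (a₂ : F), (a₃ : F), (a₄ : F)]

/-- A quadratic form is isotropic if it has a nontrivial zero. -/
def IsIsotropic {F V : Type*} [Field F] [AddCommGroup V] [Module F V]
    (Q : QuadraticForm F V) : Prop :=
  ∃ x : V, x ≠ 0 ∧ Q x = 0

/-!
Let `F` be the completion of a global field at a non-archimedean place. Its value group is discrete
and its residue field is finite, and the characteristic of `F` is not two; the argument below uses
only these facts, and treats residue characteristic two together with the others.

The heart of the proof is that an anisotropic quaternary form `q` over `F` has square discriminant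
(`quaternaryFormsIsotropic_of_isNormUniformizer`). By Hensel's lemma, `‖q ·‖` satisfies the
ultrametric inequality, so that `‖q x‖ ≤ 1` defines a lattice. On its quotient by `‖q x‖ < 1`, and
on the quotient of the latter lattice by `π` times the former, `q` and `π⁻¹ q` induce anisotropic
forms over the finite residue field. By Chevalley–Warning both quotients have dimension at most two,
and lifts of bases span the whole space; so both have dimension exactly two, and `q` is an
orthogonal sum of two planes, each a scaled form `A x² + B x y + C y²` with integral coefficients
and anisotropic reduction. All such planes have the same discriminant up to squares
(`isSquare_disc_mul_disc`), that of the unramified quadratic extension.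

For a nontrivial discriminant the form is therefore isotropic. For a trivial one, put
`e = -a₁ a₂`, which is `-a₃ a₄` up to squares. Then `(a₁, a₂) = 1` if and only if `a₁` is a norm
from `F(√e)`, `(-a₃, -a₄) = 1` if and only if `-a₃` is one, and the form is isotropic if and only
if `-a₁ a₃` is one (`isotropic_iff_isNormValue`). Thus it remains to see that the norm group of `e`
has index at most two. For the unramified extension the norms are the elements of even valuation
(`isNormValue_unramified_iff`). The general case follows from this one and the isotropy of
quaternary forms with nontrivial discriminant (`normIndexLeTwo_of_one`): if `d` is the unramified
discriminant, each coset of the norm group of `e` other than the trivial one meets the norm group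
of `e d`, in an element that cannot be a norm for `d`.
-/

/-! ### Binary norm forms and the Hilbert symbol over a field -/

/-- `a` is a value of the binary form `u² - e v²`, the norm form of `F(√e)` when `e` is not a
square. For `a ≠ 0` this says that `(a, e) = 1`. -/
def IsNormValue {F : Type*} [Field F] (e a : F) : Prop :=
  ∃ u v : F, a = u ^ 2 - e * v ^ 2

namespace IsNormValue

variable {F : Type*} [Field F] {e f a b : F}

theorem mul (ha : IsNormValue e a) (hb : IsNormValue e b) : IsNormValue e (a * b) := by
  obtain ⟨u, v, rfl⟩ := ha
  obtain ⟨x, y, rfl⟩ := hb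
  exact ⟨u * x + e * v * y, u * y + v * x, by ring⟩

theorem neg_self (e : F) : IsNormValue e (-e) := ⟨0, 1, by ring⟩

theorem of_mul_sq {s : F} (hs : s ≠ 0) (h : IsNormValue e (a * s ^ 2)) : IsNormValue e a := by
  obtain ⟨u, v, h⟩ := h
  refine ⟨u / s, v / s, ?_⟩
  field_simp
  exact h

theorem of_mul_right (hb : b ≠ 0) (hab : IsNormValue e (a * b)) (h : IsNormValue e b) :
    IsNormValue e a :=
  of_mul_sq hb (by simpa [pow_two, mul_assoc] using hab.mul h)

theorem of_isSquare (h2 : (2 : F) ≠ 0) (he : e ≠ 0) (hsq : IsSquare e) (a : F) :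
    IsNormValue e a := by
  obtain ⟨s, rfl⟩ := hsq
  have hs : s ≠ 0 := by rintro rfl; simp at he
  refine ⟨(a + 1) / 2, (a - 1) / (2 * s), ?_⟩
  field_simp
  ring

theorem symm (h2 : (2 : F) ≠ 0) (ha : a ≠ 0) (h : IsNormValue e a) : IsNormValue a e := by
  obtain ⟨u, v, h⟩ := h
  by_cases hv : v = 0
  · subst hv
    exact of_isSquare h2 ha ⟨u, by rw [h]; ring⟩ e
  · refine ⟨u / v, 1 / v, ?_⟩
    field_simp
    rw [h]
    ring

theorem mul_left (h2 : (2 : F) ≠ 0) (he : e ≠ 0) (hf : f ≠ 0) (ha : a ≠ 0)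
    (h : IsNormValue e a) (h' : IsNormValue f a) : IsNormValue (e * f) a :=
  ((h.symm h2 ha).mul (h'.symm h2 ha)).symm h2 (mul_ne_zero he hf)

theorem mul_sq_left_iff {s : F} (hs : s ≠ 0) : IsNormValue (e * s ^ 2) a ↔ IsNormValue e a := by
  constructor
  · rintro ⟨u, v, h⟩
    exact ⟨u, s * v, by rw [h]; ring⟩
  · rintro ⟨u, v, h⟩
    exact ⟨u, v / s, by rw [h]; field_simp⟩

end IsNormValue

open IsNormValue

section Field

variable {F : Type*} [Field F]

theorem hilbertSymbol_eq_one_or (a b : Fˣ) : hilbertSymbol a b = 1 ∨ hilbertSymbol a b = -1 := by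
  unfold hilbertSymbol
  split_ifs <;> simp

theorem hilbertSymbol_eq_one_iff (h2 : (2 : F) ≠ 0) (a b : Fˣ) :
    hilbertSymbol a b = 1 ↔ IsNormValue (b : F) (a : F) := by
  have key : (∃ x y z : F, (x, y, z) ≠ (0, 0, 0) ∧ z ^ 2 = (a : F) * x ^ 2 + (b : F) * y ^ 2) ↔
      IsNormValue (b : F) (a : F) := by
    constructor
    · rintro ⟨x, y, z, hne, h⟩
      by_cases hx : x = 0
      · subst hx
        have hy : y ≠ 0 := by
          rintro rfl
          apply hne
          have : z ^ 2 = 0 := by rw [h]; ring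
          simp [pow_eq_zero_iff] at this
          simp [this]
        refine of_isSquare h2 b.ne_zero ⟨z / y, ?_⟩ _
        field_simp
        rw [h]
        ring
      · refine ⟨z / x, y / x, ?_⟩
        field_simp
        rw [h]
        ring
    · rintro ⟨u, v, h⟩
      exact ⟨1, v, u, by simp, by rw [h]; ring⟩
  rw [← key, hilbertSymbol]
  split_ifs with h
  · exact iff_of_true rfl h
  · exact iff_of_false (by norm_num) h

theorem hilbertSymbol_ne_neg_iff (h2 : (2 : F) ≠ 0) (a b c d : Fˣ) :
    hilbertSymbol a b ≠ -hilbertSymbol c d ↔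
      (IsNormValue (b : F) (a : F) ↔ IsNormValue (d : F) (c : F)) := by
  rw [← hilbertSymbol_eq_one_iff h2, ← hilbertSymbol_eq_one_iff h2]
  rcases hilbertSymbol_eq_one_or a b with h | h <;>
    rcases hilbertSymbol_eq_one_or c d with h' | h' <;> rw [h, h'] <;> norm_num

theorem isNormValue_iff_neg_mul (h2 : (2 : F) ≠ 0) {a b : F} (ha : a ≠ 0) (hb : b ≠ 0) :
    IsNormValue b a ↔ IsNormValue (-(a * b)) a := by
  have h : IsNormValue (-a) a := by simpa using neg_self (-a)
  have ha' : -a ≠ 0 := neg_ne_zero.2 ha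
  constructor
  · intro h'
    simpa using mul_left h2 ha' hb ha h h'
  · intro h'
    have := mul_left h2 (neg_ne_zero.2 (mul_ne_zero ha hb)) ha' ha h' h
    rw [← mul_sq_left_iff ha]
    convert this using 1
    ring

theorem squareClass_eq_iff (a b : Fˣ) :
    squareClass a = squareClass b ↔ ∃ s : F, s ≠ 0 ∧ (a : F) = b * s ^ 2 := by
  rw [squareClass, squareClass, QuotientGroup.eq, Subgroup.mem_square]
  constructor
  · rintro ⟨r, hr⟩
    refine ⟨((r⁻¹ : Fˣ) : F), r⁻¹.ne_zero, ?_⟩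
    have : b = a * (r * r) := by rw [← hr]; simp
    rw [this]
    push_cast
    field_simp
  · rintro ⟨s, hs, h⟩
    refine ⟨(Units.mk0 s hs)⁻¹, ?_⟩
    ext
    push_cast
    rw [h]
    simp only [Units.val_mk0]
    field_simp

theorem isIsotropic_quaternaryForm_iff (a₁ a₂ a₃ a₄ : Fˣ) :
    IsIsotropic (quaternaryForm a₁ a₂ a₃ a₄) ↔ ∃ x y z w : F, (x ≠ 0 ∨ y ≠ 0 ∨ z ≠ 0 ∨ w ≠ 0) ∧
      (a₁ : F) * x ^ 2 + a₂ * y ^ 2 + a₃ * z ^ 2 + a₄ * w ^ 2 = 0 := by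
  constructor
  · rintro ⟨x, hx, h⟩
    refine ⟨x 0, x 1, x 2, x 3, ?_, ?_⟩
    · by_contra! hc
      apply hx
      ext i
      fin_cases i <;> simp [hc]
    · simpa [quaternaryForm, QuadraticMap.weightedSumSquares_apply, Fin.sum_univ_four,
        pow_two] using h
  · rintro ⟨x, y, z, w, hne, h⟩
    refine ⟨![x, y, z, w], ?_, ?_⟩
    · intro hc
      have h0 := congrFun hc 0
      have h1 := congrFun hc 1
      have h2 := congrFun hc 2
      have h3 := congrFun hc 3
      simp at h0 h1 h2 h3
      simp [h0, h1, h2, h3] at hne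
    · simpa [quaternaryForm, QuadraticMap.weightedSumSquares_apply, Fin.sum_univ_four,
        pow_two] using h

/-- A binary form with a nontrivial zero has minus its discriminant a square. -/
theorem isSquare_of_binary_zero {a b x y : F} (ha : a ≠ 0) (hne : x ≠ 0 ∨ y ≠ 0)
    (h : a * x ^ 2 + b * y ^ 2 = 0) : IsSquare (-(a * b)) := by
  by_cases hy : y = 0
  · subst hy
    simp [ha] at h
    simp [h] at hne
  · refine ⟨a * x / y, ?_⟩
    field_simp
    linear_combination -h

/-- For trivial discriminant, isotropy means that two cosets of a norm group coincide. -/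
theorem isotropic_iff_isNormValue (h2 : (2 : F) ≠ 0) {a₁ a₂ a₃ a₄ s : F} (h₁ : a₁ ≠ 0)
    (h₂ : a₂ ≠ 0) (h₃ : a₃ ≠ 0) (hs : s ≠ 0) (hd : a₁ * a₂ = a₃ * a₄ * s ^ 2) :
    (∃ x y z w : F, (x ≠ 0 ∨ y ≠ 0 ∨ z ≠ 0 ∨ w ≠ 0) ∧
      a₁ * x ^ 2 + a₂ * y ^ 2 + a₃ * z ^ 2 + a₄ * w ^ 2 = 0) ↔
      IsNormValue (-(a₁ * a₂)) (-(a₁ * a₃)) := by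
  have he : -(a₁ * a₂) ≠ 0 := neg_ne_zero.2 (mul_ne_zero h₁ h₂)
  constructor
  · rintro ⟨x, y, z, w, hne, h⟩
    by_cases ht : a₁ * x ^ 2 + a₂ * y ^ 2 = 0
    · refine of_isSquare h2 he ?_ _
      by_cases hxy : x ≠ 0 ∨ y ≠ 0
      · exact isSquare_of_binary_zero h₁ hxy ht
      · have hzw : z ≠ 0 ∨ w ≠ 0 := by tauto
        obtain ⟨r, hr⟩ := isSquare_of_binary_zero h₃ hzw (b := a₄)
          (by linear_combination h - ht)
        exact ⟨r * s, by linear_combination -hd + s ^ 2 * hr⟩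
    · have n₁ : IsNormValue (-(a₁ * a₂)) (a₁ * (a₁ * x ^ 2 + a₂ * y ^ 2)) :=
        ⟨a₁ * x, y, by ring⟩
      have n₂ : IsNormValue (-(a₁ * a₂)) (-a₃ * (a₁ * x ^ 2 + a₂ * y ^ 2)) := by
        refine ⟨a₃ * z, w / s, ?_⟩
        field_simp
        linear_combination (-a₃ * s ^ 2) * h - w ^ 2 * hd
      refine of_mul_sq ht ?_
      convert n₁.mul n₂ using 1
      ring
  · rintro ⟨u, v, h⟩
    refine ⟨u / a₁, v, 1, 0, by simp, ?_⟩
    field_simp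
    linear_combination -h

theorem isNormValue_disc_iff (h2 : (2 : F) ≠ 0) (c a : F) :
    IsNormValue (1 - 4 * c) a ↔ ∃ x y : F, a = x ^ 2 + x * y + c * y ^ 2 := by
  constructor
  · rintro ⟨u, v, h⟩
    exact ⟨u - v, 2 * v, by rw [h]; ring⟩
  · rintro ⟨x, y, h⟩
    refine ⟨x + y / 2, y / 2, ?_⟩
    rw [h]
    field_simp
    ring

variable (F) in
/-- Over `F`, every nondegenerate quaternary diagonal form with nontrivial discriminant is
isotropic. -/
def QuaternaryFormsIsotropic : Prop :=
  ∀ a b c d : F, a ≠ 0 → b ≠ 0 → c ≠ 0 → d ≠ 0 → ¬ IsSquare (a * b * c * d) →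
    ∃ x y z w : F, (x ≠ 0 ∨ y ≠ 0 ∨ z ≠ 0 ∨ w ≠ 0) ∧
      a * x ^ 2 + b * y ^ 2 + c * z ^ 2 + d * w ^ 2 = 0

/-- The nonzero values of `u² - e v²` form a subgroup of `Fˣ` of index at most two. -/
def NormIndexLeTwo (e : F) : Prop :=
  ∀ a b : F, a ≠ 0 → b ≠ 0 → ¬ IsNormValue e a → ¬ IsNormValue e b → IsNormValue e (a * b)

/-- If quaternary forms of nontrivial discriminant are isotropic, then every coset of the norm
group of `e` that is not the trivial one contains a norm for `e * d`: apply the hypothesis to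
`a⟨1, -e⟩ ⊥ -⟨1, -ed⟩`. -/
theorem exists_mul_isNormValue (h2 : (2 : F) ≠ 0) (hF : QuaternaryFormsIsotropic F) {e d a : F}
    (he : e ≠ 0) (hd : d ≠ 0) (hsq : ¬ IsSquare d) (ha : a ≠ 0) (hna : ¬ IsNormValue e a) :
    ∃ n, n ≠ 0 ∧ IsNormValue e n ∧ IsNormValue (e * d) (a * n) := by
  obtain ⟨x, y, z, w, hne, h⟩ := hF a (-(a * e)) (-1) (e * d) ha
    (neg_ne_zero.2 (mul_ne_zero ha he)) (by simp) (mul_ne_zero he hd) (by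
      rintro ⟨r, hr⟩
      refine hsq ⟨r / (a * e), ?_⟩
      field_simp
      linear_combination hr)
  by_cases ht : x ^ 2 - e * y ^ 2 = 0
  · by_cases hxy : x ≠ 0 ∨ y ≠ 0
    · refine absurd (of_isSquare h2 he ?_ a) hna
      have := isSquare_of_binary_zero (a := 1) (b := -e) one_ne_zero hxy
        (by linear_combination ht)
      simpa using this
    · refine ⟨1, one_ne_zero, ⟨1, 0, by ring⟩, of_isSquare h2 (mul_ne_zero he hd) ?_ _⟩
      have := isSquare_of_binary_zero (a := 1) (b := -(e * d)) (x := z) (y := w) one_ne_zero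
        (by tauto) (by linear_combination -h + a * ht)
      simpa using this
  · exact ⟨_, ht, ⟨x, y, rfl⟩, z, w, by linear_combination h⟩

/-- The norm groups all have index at most two as soon as one of them, for a nonsquare `d`, has. -/
theorem normIndexLeTwo_of_one (h2 : (2 : F) ≠ 0) (hF : QuaternaryFormsIsotropic F) {d : F}
    (hd : d ≠ 0) (hsq : ¬ IsSquare d) (hidx : NormIndexLeTwo d) {e : F} (he : e ≠ 0) :
    NormIndexLeTwo e := by
  intro a b ha hb hna hnb
  -- representatives of the cosets of `a` and `b` that are norms for `e * d`, hence not for `d`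
  have key : ∀ a : F, a ≠ 0 → ¬ IsNormValue e a → ∃ n, n ≠ 0 ∧ IsNormValue e n ∧
      IsNormValue (e * d) (a * n) ∧ ¬ IsNormValue d (a * n) := by
    intro a ha hna
    obtain ⟨n, hn, hen, hedn⟩ := exists_mul_isNormValue h2 hF he hd hsq ha hna
    refine ⟨n, hn, hen, hedn, fun hdn ↦ hna (of_mul_right hn ?_ hen)⟩
    have := mul_left h2 (mul_ne_zero he hd) hd (mul_ne_zero ha hn) hedn hdn
    rw [← mul_sq_left_iff hd]
    convert this using 1
    ring
  obtain ⟨m, hm, hem, hedm, hdm⟩ := key a ha hna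
  obtain ⟨n, hn, hen, hedn, hdn⟩ := key b hb hnb
  have ham := mul_ne_zero ha hm
  have hbn := mul_ne_zero hb hn
  have h₁ := mul_left h2 (mul_ne_zero he hd) hd (mul_ne_zero ham hbn) (hedm.mul hedn)
    (hidx _ _ ham hbn hdm hdn)
  refine of_mul_right (mul_ne_zero hm hn) ?_ (hem.mul hen)
  rw [← mul_sq_left_iff hd]
  convert h₁ using 1 <;> ring

/-- The isotropy criterion over any field, of characteristic not two, in which quaternary forms
of nontrivial discriminant are isotropic and norm groups have index at most two. -/
theorem isIsotropic_quaternaryForm_iff_of_norm_index (h2 : (2 : F) ≠ 0)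
    (hF : QuaternaryFormsIsotropic F) (hidx : ∀ e : F, e ≠ 0 → NormIndexLeTwo e)
    (a₁ a₂ a₃ a₄ : Fˣ) :
    IsIsotropic (quaternaryForm a₁ a₂ a₃ a₄) ↔
      (squareClass (a₁ * a₂) ≠ squareClass (a₃ * a₄) ∨
        hilbertSymbol a₁ a₂ ≠ -hilbertSymbol (-a₃) (-a₄)) := by
  rw [isIsotropic_quaternaryForm_iff, hilbertSymbol_ne_neg_iff h2]
  by_cases hd : squareClass (a₁ * a₂) = squareClass (a₃ * a₄)
  · obtain ⟨s, hs, hd'⟩ := (squareClass_eq_iff _ _).1 hd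
    push_cast at hd' ⊢
    rw [isotropic_iff_isNormValue h2 a₁.ne_zero a₂.ne_zero a₃.ne_zero hs hd',
      isNormValue_iff_neg_mul h2 a₁.ne_zero a₂.ne_zero,
      isNormValue_iff_neg_mul h2 (neg_ne_zero.2 a₃.ne_zero) (neg_ne_zero.2 a₄.ne_zero),
      neg_mul_neg, ← mul_sq_left_iff hs (e := -((a₃ : F) * a₄)),
      show -((a₃ : F) * a₄) * s ^ 2 = -(a₁ * a₂) by rw [hd']; ring,
      show -((a₁ : F) * a₃) = a₁ * -a₃ by ring]
    simp only [hd, ne_eq, not_true_eq_false, false_or]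
    constructor
    · intro h
      refine ⟨fun h₁ ↦ ?_, fun h₃ ↦ of_mul_right (neg_ne_zero.2 a₃.ne_zero) h h₃⟩
      exact of_mul_right a₁.ne_zero (by rwa [mul_comm (a₁ : F) (-a₃)] at h) h₁
    · intro h
      by_cases h₁ : IsNormValue (-((a₁ : F) * a₂)) a₁
      · exact h₁.mul (h.1 h₁)
      · exact hidx _ (neg_ne_zero.2 (mul_ne_zero a₁.ne_zero a₂.ne_zero)) _ _ a₁.ne_zero
          (neg_ne_zero.2 a₃.ne_zero) h₁ (fun h₃ ↦ h₁ (h.2 h₃))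
  · refine iff_of_true (hF _ _ _ _ a₁.ne_zero a₂.ne_zero a₃.ne_zero a₄.ne_zero ?_) (Or.inl hd)
    rintro ⟨r, hr⟩
    refine hd ((squareClass_eq_iff _ _).2 ⟨r / (a₃ * a₄), ?_, ?_⟩)
    · have : r ≠ 0 := by rintro rfl; simp at hr
      simp [this]
    · push_cast
      have h₃ := a₃.ne_zero
      have h₄ := a₄.ne_zero
      field_simp
      linear_combination hr

end Field

/-! ### Quadratic forms over finite fields -/

section FiniteField

variable {k : Type*} [Field k]

/-- The binary form `A x² + B x y + C y²` has no nontrivial zero. -/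
def BinaryAnisotropic (A B C : k) : Prop :=
  ∀ x y : k, A * x ^ 2 + B * x * y + C * y ^ 2 = 0 → x = 0 ∧ y = 0

/-- A ternary quadratic form over a finite field has a nontrivial zero, by Chevalley–Warning. -/
theorem exists_ternary_zero [Finite k] (a b c d e f : k) :
    ∃ x y z : k, (x ≠ 0 ∨ y ≠ 0 ∨ z ≠ 0) ∧
      a * x ^ 2 + b * y ^ 2 + c * z ^ 2 + d * x * y + e * x * z + f * y * z = 0 := by
  classical
  have := Fintype.ofFinite k
  open MvPolynomial in
  let P : MvPolynomial (Fin 3) k :=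
    C a * (X 0 * X 0) + C b * (X 1 * X 1) + C c * (X 2 * X 2) + C d * (X 0 * X 1) +
      C e * (X 0 * X 2) + C f * (X 1 * X 2)
  have hmon : ∀ (r : k) (i j : Fin 3),
      (MvPolynomial.C r * (MvPolynomial.X i * MvPolynomial.X j) :
        MvPolynomial (Fin 3) k).IsHomogeneous 2 := fun r i j ↦ by
    simpa using (MvPolynomial.isHomogeneous_C (Fin 3) r).mul
      ((MvPolynomial.isHomogeneous_X k i).mul (MvPolynomial.isHomogeneous_X k j))
  have hP : P.IsHomogeneous 2 :=
    (((((hmon a 0 0).add (hmon b 1 1)).add (hmon c 2 2)).add (hmon d 0 1)).add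
      (hmon e 0 2)).add (hmon f 1 2)
  have hdeg : P.totalDegree < Fintype.card (Fin 3) :=
    lt_of_le_of_lt hP.totalDegree_le (by simp)
  obtain ⟨p, hp⟩ := CharP.exists k
  have hprime : p.Prime := (CharP.char_is_prime_or_zero k p).resolve_right
    (CharP.char_ne_zero_of_finite k p)
  have hdvd := char_dvd_card_solutions p hdeg
  have hev : ∀ v : Fin 3 → k, MvPolynomial.eval v P =
      a * v 0 ^ 2 + b * v 1 ^ 2 + c * v 2 ^ 2 + d * v 0 * v 1 + e * v 0 * v 2 + f * v 1 * v 2 := by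
    intro v
    simp [P]
    ring
  have h0 : MvPolynomial.eval (0 : Fin 3 → k) P = 0 := by rw [hev]; simp
  have hcard : 1 < Fintype.card {v : Fin 3 → k // MvPolynomial.eval v P = 0} := by
    refine lt_of_lt_of_le hprime.one_lt (Nat.le_of_dvd ?_ hdvd)
    exact Fintype.card_pos_iff.2 ⟨⟨0, h0⟩⟩
  obtain ⟨⟨v, hv⟩, hne⟩ := Fintype.exists_ne_of_one_lt_card hcard ⟨0, h0⟩
  refine ⟨v 0, v 1, v 2, ?_, by rw [← hev, hv]⟩
  by_contra! hc
  apply hne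
  ext i
  fin_cases i <;> simp [hc]

namespace BinaryAnisotropic

variable {A B C : k}

theorem left_ne_zero (h : BinaryAnisotropic A B C) : A ≠ 0 := fun hA ↦
  one_ne_zero (h 1 0 (by rw [hA]; ring)).1

theorem right_ne_zero (h : BinaryAnisotropic A B C) : C ≠ 0 := fun hC ↦
  one_ne_zero (h 0 1 (by rw [hC]; ring)).2

theorem not_isSquare_disc (h2 : (2 : k) ≠ 0) (h : BinaryAnisotropic A B C) :
    ¬ IsSquare (B ^ 2 - 4 * A * C) := by
  rintro ⟨s, hs⟩
  -- the vector given by the quadratic formula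
  have := (h (s - B) (2 * A) (by linear_combination -A * hs)).2
  exact mul_ne_zero h2 h.left_ne_zero this

/-- In characteristic two, squaring is bijective on a finite field, so that a diagonal binary form
has a zero. -/
theorem middle_ne_zero [Finite k] (h2 : (2 : k) = 0) (h : BinaryAnisotropic A B C) : B ≠ 0 := by
  rintro rfl
  have := CharTwo.of_one_ne_zero_of_two_eq_zero one_ne_zero h2
  obtain ⟨s, hs⟩ := FiniteField.isSquare_of_char_two (F := k) (CharP.eq k (ringChar.charP k) this)
    (-C / A)
  have hA := h.left_ne_zero
  refine one_ne_zero (h s 1 ?_).2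
  rw [div_eq_iff hA] at hs
  linear_combination -hs

theorem disc_ne_zero [Finite k] (h : BinaryAnisotropic A B C) : B ^ 2 - 4 * A * C ≠ 0 := by
  by_cases h2 : (2 : k) = 0
  · have h4 : (4 : k) = 0 := by linear_combination 2 * h2
    simpa [h4] using h.middle_ne_zero h2
  · exact fun h0 ↦ h.not_isSquare_disc h2 (by rw [h0]; simp)

/-- The substitution `x = B X / A`, `y = 1` shows that the polynomial `X² + X + AC/B²` has
no root. -/
theorem no_root (h : BinaryAnisotropic A B C) {b : k} (hb : B * b = 1) (s : k) :
    s ^ 2 + s + A * C * b ^ 2 ≠ 0 := by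
  intro hs
  have hA := h.left_ne_zero
  refine one_ne_zero (h (B * s / A) 1 ?_).2
  field_simp
  linear_combination B ^ 2 * hs - A * C * (B * b + 1) * hb

/-- A value of an anisotropic form `x² + x y + c y²` over a finite field can be prescribed. -/
theorem exists_eq [Finite k] {c : k} (h : BinaryAnisotropic 1 1 c) (u : k) :
    ∃ x y : k, x ^ 2 + x * y + c * y ^ 2 = u := by
  obtain ⟨x, y, z, hne, hz⟩ := exists_ternary_zero 1 c (-u) 1 0 0
  by_cases hz0 : z = 0
  · subst hz0
    have := h x y (by linear_combination hz)
    simp [this] at hne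
  · refine ⟨x / z, y / z, ?_⟩
    field_simp
    linear_combination hz

end BinaryAnisotropic

/-- In a finite field of characteristic two, the image of `s ↦ s² + s` has index two. -/
theorem exists_root_add [Finite k] (h2 : (2 : k) = 0) {c d : k}
    (hc : ∀ s : k, s ^ 2 + s + c ≠ 0) (hd : ∀ s : k, s ^ 2 + s + d ≠ 0) :
    ∃ s : k, s ^ 2 + s + (c + d) = 0 := by
  let f : k →+ k :=
    { toFun := fun s ↦ s ^ 2 + s
      map_zero' := by simp
      map_add' := fun x y ↦ by linear_combination x * y * h2 }
  have hneg : ∀ x : k, -x = x := fun x ↦ by linear_combination -x * h2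
  have hker : Nat.card f.ker = 2 := by
    have : (f.ker : Set k) = {0, 1} := by
      ext x
      simp only [SetLike.mem_coe, AddMonoidHom.mem_ker, Set.mem_insert_iff, Set.mem_singleton_iff]
      change x ^ 2 + x = 0 ↔ _
      constructor
      · intro h
        have : x * (x + 1) = 0 := by linear_combination h
        rcases mul_eq_zero.1 this with h | h
        · exact Or.inl h
        · exact Or.inr (by linear_combination h - h2)
      · rintro (rfl | rfl)
        · simp
        · linear_combination h2
    have h' : Nat.card (f.ker : Set k) = 2 := by
      rw [this, Nat.card_coe_set_eq]
      exact Set.ncard_pair zero_ne_one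
    exact h'
  have hidx : f.range.index = 2 := by
    have h₁ := f.range.card_mul_index
    have h₂ := f.ker.card_mul_index
    rw [AddSubgroup.index_ker, hker] at h₂
    have h₃ : 0 < Nat.card f.range := Nat.card_pos
    rw [← h₂, mul_comm 2] at h₁
    exact Nat.eq_of_mul_eq_mul_left h₃ h₁
  have hmem : c + d ∈ f.range := by
    rw [AddSubgroup.add_mem_iff_of_index_two hidx]
    refine iff_of_false ?_ ?_
    · rintro ⟨s, hs⟩
      refine hc s ?_
      change s ^ 2 + s = c at hs
      linear_combination hs + c * h2
    · rintro ⟨s, hs⟩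
      refine hd s ?_
      change s ^ 2 + s = d at hs
      linear_combination hs + d * h2
  obtain ⟨s, hs⟩ := hmem
  change s ^ 2 + s = c + d at hs
  exact ⟨s, by linear_combination hs + (c + d) * h2⟩

/-- Over a finite field there is an anisotropic form `x² + x y + c y²`, because `s ↦ s² + s` takes
the value `0` twice and so is not surjective. -/
theorem exists_binaryAnisotropic (k : Type*) [Field k] [Finite k] :
    ∃ c : k, BinaryAnisotropic 1 1 c := by
  have hns : ¬ Function.Surjective (fun s : k ↦ s ^ 2 + s) := by
    rw [← Finite.injective_iff_surjective]
    intro hinj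
    have : (0 : k) = -1 := hinj (by ring)
    simp at this
  rw [Function.Surjective] at hns
  push Not at hns
  obtain ⟨c, hc⟩ := hns
  refine ⟨-c, fun x y h ↦ ?_⟩
  by_cases hy : y = 0
  · subst hy
    simpa using h
  · refine absurd ?_ (hc (x / y))
    field_simp
    linear_combination h

end FiniteField

/-! ### Uniformizers and valuation rings of normed fields -/

section UnitBall

/-- `π` is a nonzero generator of the maximal ideal of the valuation ring, expressed through the
norm: it has the largest norm less than one. -/
structure IsNormUniformizer {F : Type*} [NormedField F] (π : F) : Prop where
  ne_zero : π ≠ 0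
  norm_lt_one : ‖π‖ < 1
  norm_le : ∀ x : F, ‖x‖ < 1 → ‖x‖ ≤ ‖π‖

theorem IsNormUniformizer.exists_zpow {F : Type*} [NormedField F] {π : F} (hπ : IsNormUniformizer π) {x : F} (hx : x ≠ 0) :
    ∃ n : ℤ, ‖x‖ = ‖π‖ ^ n := by
  have hpos : 0 < ‖π‖ := norm_pos_iff.2 hπ.ne_zero
  obtain ⟨n, hn₁, hn₂⟩ := exists_mem_Ioc_zpow (norm_pos_iff.2 hx)
    ((one_lt_inv₀ hpos).2 hπ.norm_lt_one)
  refine ⟨-(n + 1), ?_⟩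
  rw [← inv_zpow']
  refine le_antisymm hn₂ ?_
  have hy : ¬ ‖x * π ^ (n + 1)‖ < 1 := by
    intro hlt
    have h := hπ.norm_le _ hlt
    rw [norm_mul, norm_zpow, zpow_add_one₀ hpos.ne', ← mul_assoc] at h
    rw [inv_zpow'] at hn₁
    have h₁ : ‖x‖ * ‖π‖ ^ n ≤ 1 := le_of_mul_le_mul_right (by rwa [one_mul]) hpos
    rw [zpow_neg, inv_lt_iff_one_lt_mul₀ (zpow_pos hpos n)] at hn₁
    linarith
  rw [norm_mul, norm_zpow, not_lt] at hy
  rw [inv_zpow']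
  rwa [zpow_neg, inv_le_iff_one_le_mul₀ (zpow_pos hpos _)]

/-- The valuation ring `{x | ‖x‖ ≤ 1}` of a field with a non-archimedean norm. -/
noncomputable abbrev unitBall (F : Type*) [NormedField F] [IsUltrametricDist F] :
    ValuationSubring F :=
  (NormedField.valuation (K := F)).valuationSubring

/-- The residue field of the valuation ring of a field with a non-archimedean norm. -/
abbrev ballResidueField (F : Type*) [NormedField F] [IsUltrametricDist F] : Type _ :=
  IsLocalRing.ResidueField (unitBall F)

variable {F : Type*} [NormedField F] [IsUltrametricDist F]

theorem mem_unitBall {x : F} : x ∈ unitBall F ↔ ‖x‖ ≤ 1 := Iff.rfl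

/-- The reduction map. -/
noncomputable abbrev red : unitBall F →+* ballResidueField F := IsLocalRing.residue (unitBall F)

theorem red_eq_zero_iff {x : unitBall F} : red x = 0 ↔ ‖(x : F)‖ < 1 := by
  rw [IsLocalRing.residue_eq_zero_iff, Valuation.mem_maximalIdeal_iff]
  rfl

theorem red_surjective : Function.Surjective (red (F := F)) := IsLocalRing.residue_surjective

theorem norm_eq_one_of_red_ne_zero {x : unitBall F} (h : red x ≠ 0) : ‖(x : F)‖ = 1 :=
  le_antisymm (mem_unitBall.1 x.2) (not_lt.1 (fun h' ↦ h (red_eq_zero_iff.2 h')))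

theorem exists_mul_eq_one_of_red_ne_zero {x : unitBall F} (h : red x ≠ 0) :
    ∃ y : unitBall F, x * y = 1 := by
  have hx := norm_eq_one_of_red_ne_zero h
  have hx0 : (x : F) ≠ 0 := by
    intro h0
    rw [h0] at hx
    simp at hx
  refine ⟨⟨(x : F)⁻¹, mem_unitBall.2 (by simp [hx])⟩, ?_⟩
  ext
  exact mul_inv_cancel₀ hx0

theorem norm_natCast_le (n : ℕ) : ‖(n : F)‖ ≤ 1 := IsUltrametricDist.norm_natCast_le_one F n

/-! ### Hensel's lemma for quadratic polynomials -/

/-- The equation `t² + t + c = 0` is solved by iterating the contraction `t ↦ -c - t²`. -/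
theorem exists_root_of_norm_lt_one [CompleteSpace F] {c : F} (hc : ‖c‖ < 1) :
    ∃ t : F, t ^ 2 + t + c = 0 ∧ ‖t‖ < 1 := by
  let f : F → F := fun t ↦ -c - t ^ 2
  let s : Set F := Metric.closedBall 0 ‖c‖
  have hmaps : Set.MapsTo f s s := by
    intro t ht
    simp only [s, mem_closedBall_zero_iff] at ht ⊢
    change ‖-c - t ^ 2‖ ≤ ‖c‖
    rw [sub_eq_add_neg]
    refine (IsUltrametricDist.norm_add_le_max _ _).trans (max_le (by simp) ?_)
    rw [norm_neg, norm_pow]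
    nlinarith [norm_nonneg t]
  have hcontr : ContractingWith ‖c‖₊ (hmaps.restrict f s s) := by
    refine ⟨by exact_mod_cast hc, LipschitzWith.of_dist_le_mul ?_⟩
    rintro ⟨x, hx⟩ ⟨y, hy⟩
    simp only [s, mem_closedBall_zero_iff] at hx hy
    change dist (-c - x ^ 2) (-c - y ^ 2) ≤ ‖c‖ * dist x y
    rw [dist_eq_norm, dist_eq_norm,
      show -c - x ^ 2 - (-c - y ^ 2) = -((x + y) * (x - y)) by ring, norm_neg, norm_mul]
    gcongr
    exact (IsUltrametricDist.norm_add_le_max _ _).trans (max_le hx hy)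
  obtain ⟨y, hy, hfix, -⟩ := hcontr.exists_fixedPoint' (Metric.isClosed_closedBall.isComplete)
    hmaps (x := 0) (by simp [s]) (edist_ne_top _ _)
  refine ⟨y, ?_, ?_⟩
  · have : -c - y ^ 2 = y := hfix
    linear_combination -this
  · simp only [s, mem_closedBall_zero_iff] at hy
    exact hy.trans_lt hc

/-- Simple roots of the reduction of a monic quadratic polynomial lift. -/
theorem exists_root_of_simple_root [CompleteSpace F] (b c x : unitBall F)
    (h : red (x ^ 2 + b * x + c) = 0) (h' : red (2 * x + b) ≠ 0) :
    ∃ y : unitBall F, y ^ 2 + b * y + c = 0 := by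
  obtain ⟨d, hd⟩ := exists_mul_eq_one_of_red_ne_zero h'
  have hsmall : ‖(((x ^ 2 + b * x + c) * d ^ 2 : unitBall F) : F)‖ < 1 := by
    rw [← red_eq_zero_iff, map_mul, h, zero_mul]
  obtain ⟨t, ht, htn⟩ := exists_root_of_norm_lt_one hsmall
  let t' : unitBall F := ⟨t, mem_unitBall.2 htn.le⟩
  have ht' : t' ^ 2 + t' + (x ^ 2 + b * x + c) * d ^ 2 = 0 := by
    ext
    simpa [t'] using ht
  refine ⟨x + (2 * x + b) * t', ?_⟩
  linear_combination (2 * x + b) ^ 2 * ht' -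
    (x ^ 2 + b * x + c) * ((2 * x + b) * d + 1) * hd

/-- The discriminants of two binary forms with anisotropic reductions lie in the same square
class: both define the unramified quadratic extension. -/
theorem isSquare_disc_mul_disc [CompleteSpace F] [Finite (ballResidueField F)]
    {A B C A' B' C' : unitBall F} (h : BinaryAnisotropic (red A) (red B) (red C))
    (h' : BinaryAnisotropic (red A') (red B') (red C')) :
    ∃ r : unitBall F, (B ^ 2 - 4 * A * C) * (B' ^ 2 - 4 * A' * C') = r ^ 2 := by
  classical
  by_cases h2 : (2 : ballResidueField F) = 0
  · obtain ⟨b, hb⟩ := exists_mul_eq_one_of_red_ne_zero (h.middle_ne_zero h2)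
    obtain ⟨b', hb'⟩ := exists_mul_eq_one_of_red_ne_zero (h'.middle_ne_zero h2)
    obtain ⟨s, hs⟩ := exists_root_add h2 (h.no_root (by rw [← map_mul, hb, map_one]))
      (h'.no_root (by rw [← map_mul, hb', map_one]))
    obtain ⟨s, rfl⟩ := red_surjective s
    -- `(1 - 4c)(1 - 4c') = 1 - 4(c + c' - 4cc')`, which is a square if `t² + t + (c + c' - 4cc')`
    -- has a root
    obtain ⟨t, ht⟩ := exists_root_of_simple_root 1
      (A * C * b ^ 2 + A' * C' * b' ^ 2 - 4 * (A * C * b ^ 2) * (A' * C' * b' ^ 2)) s (by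
        simp only [map_add, map_mul, map_pow, map_sub, map_one, map_ofNat]
        linear_combination hs -
          2 * (red A * red C * red b ^ 2) * (red A' * red C' * red b' ^ 2) * h2) (by
        simp only [map_add, map_mul, map_ofNat, map_one, h2, zero_mul, zero_add]
        exact one_ne_zero)
    refine ⟨B * B' * (1 + 2 * t), ?_⟩
    have e : B ^ 2 - 4 * A * C = B ^ 2 * (1 - 4 * (A * C * b ^ 2)) := by
      linear_combination 4 * A * C * (B * b + 1) * hb
    have e' : B' ^ 2 - 4 * A' * C' = B' ^ 2 * (1 - 4 * (A' * C' * b' ^ 2)) := by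
      linear_combination 4 * A' * C' * (B' * b' + 1) * hb'
    rw [e, e']
    linear_combination -4 * B ^ 2 * B' ^ 2 * ht
  · have hD := h.disc_ne_zero
    have hD' := h'.disc_ne_zero
    have := Fintype.ofFinite (ballResidueField F)
    have hchar : ringChar (ballResidueField F) ≠ 2 := by
      intro hc
      exact h2 (by exact_mod_cast hc ▸ ringChar.Nat.cast_ringChar (R := ballResidueField F))
    have hsq : IsSquare ((red B ^ 2 - 4 * red A * red C) * (red B' ^ 2 - 4 * red A' * red C')) := by
      rw [← quadraticChar_one_iff_isSquare (mul_ne_zero hD hD'), map_mul,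
        quadraticChar_neg_one_iff_not_isSquare.2 (h.not_isSquare_disc h2),
        quadraticChar_neg_one_iff_not_isSquare.2 (h'.not_isSquare_disc h2)]
      norm_num
    obtain ⟨r, hr⟩ := hsq
    obtain ⟨r, rfl⟩ := red_surjective r
    obtain ⟨t, ht⟩ := exists_root_of_simple_root 0
      (-((B ^ 2 - 4 * A * C) * (B' ^ 2 - 4 * A' * C'))) r (by
        simp only [map_add, map_mul, map_pow, map_sub, map_neg, map_zero, map_ofNat]
        linear_combination -hr) (by
        rw [add_zero, map_mul, map_ofNat]
        refine mul_ne_zero h2 fun h0 ↦ mul_ne_zero hD hD' ?_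
        rw [hr, h0, zero_mul])
    exact ⟨t, by linear_combination -ht⟩

/-! ### The unramified norm group -/

/-- Units are values of `x² + x y + c y²`, the norm form of the unramified quadratic extension. -/
theorem exists_unramified_norm_eq [CompleteSpace F] [Finite (ballResidueField F)]
    {c : unitBall F} (h : BinaryAnisotropic 1 1 (red c)) {u : unitBall F} (hu : red u ≠ 0) :
    ∃ x y : unitBall F, x ^ 2 + x * y + c * y ^ 2 = u := by
  obtain ⟨x, y, hxy⟩ := h.exists_eq (red u)
  obtain ⟨x, rfl⟩ := red_surjective x
  obtain ⟨y, rfl⟩ := red_surjective y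
  by_cases hx : red (2 * x + y) = 0
  · by_cases hy : red (x + 2 * c * y) = 0
    · -- both partial derivatives vanish only at the origin, as the discriminant is a unit
      exfalso
      simp only [map_add, map_mul, map_ofNat] at hx hy
      have hy0 : red y = 0 := by
        have := h.disc_ne_zero
        have h0 : (1 ^ 2 - 4 * 1 * red c) * red y = 0 := by linear_combination hx - 2 * hy
        exact (mul_eq_zero.1 h0).resolve_left this
      have hx0 : red x = 0 := by simpa [hy0] using hy
      exact hu (by rw [← hxy, hx0, hy0]; ring)
    · obtain ⟨d, hd⟩ := exists_mul_eq_one_of_red_ne_zero h.right_ne_zero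
      have hd' : red c * red d = 1 := by rw [← map_mul, hd, map_one]
      obtain ⟨t, ht⟩ := exists_root_of_simple_root (x * d) ((x ^ 2 - u) * d) y (by
        simp only [map_add, map_mul, map_pow, map_sub]
        linear_combination red d * hxy - red y ^ 2 * hd') (by
        intro h0
        apply hy
        simp only [map_add, map_mul, map_ofNat] at h0 ⊢
        linear_combination red c * h0 - red x * hd')
      exact ⟨x, t, by linear_combination c * ht - (x * t + x ^ 2 - u) * hd⟩
  · obtain ⟨t, ht⟩ := exists_root_of_simple_root y (c * y ^ 2 - u) x (by
      simp only [map_add, map_mul, map_pow, map_sub]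
      linear_combination hxy) hx
    exact ⟨t, y, by linear_combination ht⟩

theorem norm_unramified_norm {c : unitBall F} (h : BinaryAnisotropic 1 1 (red c)) (x y : F) :
    ‖x ^ 2 + x * y + c * y ^ 2‖ = max ‖x‖ ‖y‖ ^ 2 := by
  rcases le_total ‖y‖ ‖x‖ with hle | hle
  · rw [max_eq_left hle]
    by_cases hx : x = 0
    · have hy : y = 0 := by simpa [hx] using hle
      simp [hx, hy]
    · let z : unitBall F := ⟨y / x, mem_unitBall.2 (by
        rw [norm_div]; exact div_le_one_of_le₀ hle (norm_nonneg _))⟩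
      have hz := norm_eq_one_of_red_ne_zero (x := 1 + z + c * z ^ 2) (fun h0 ↦ by
        refine one_ne_zero (h 1 (red z) ?_).1
        simp only [map_add, map_mul, map_pow, map_one] at h0
        linear_combination h0)
      rw [show x ^ 2 + x * y + c * y ^ 2 = x ^ 2 * ((1 + z + c * z ^ 2 : unitBall F) : F) by
        simp only [z, AddMemClass.coe_add, OneMemClass.coe_one, MulMemClass.coe_mul,
          SubmonoidClass.coe_pow]
        field_simp, norm_mul, hz, norm_pow, mul_one]
  · rw [max_eq_right hle]
    by_cases hy : y = 0
    · have hx : x = 0 := by simpa [hy] using hle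
      simp [hx, hy]
    · let z : unitBall F := ⟨x / y, mem_unitBall.2 (by
        rw [norm_div]; exact div_le_one_of_le₀ hle (norm_nonneg _))⟩
      have hz := norm_eq_one_of_red_ne_zero (x := z ^ 2 + z + c) (fun h0 ↦ by
        refine one_ne_zero (h (red z) 1 ?_).2
        simp only [map_add, map_pow] at h0
        linear_combination h0)
      rw [show x ^ 2 + x * y + c * y ^ 2 = y ^ 2 * ((z ^ 2 + z + c : unitBall F) : F) by
        simp only [z, AddMemClass.coe_add, SubmonoidClass.coe_pow]
        field_simp, norm_mul, hz, norm_pow, mul_one]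

/-- The norms of the unramified quadratic extension are the elements of even valuation. -/
theorem isNormValue_unramified_iff [CompleteSpace F] [Finite (ballResidueField F)]
    (h2 : (2 : F) ≠ 0) {π : F} (hπ : IsNormUniformizer π) {c : unitBall F}
    (h : BinaryAnisotropic 1 1 (red c)) {a : F} (ha : a ≠ 0) :
    IsNormValue (1 - 4 * (c : F)) a ↔ ∃ n : ℤ, ‖a‖ = ‖π‖ ^ (2 * n) := by
  rw [isNormValue_disc_iff h2]
  constructor
  · rintro ⟨x, y, hxy⟩
    rw [hxy, norm_unramified_norm h]
    obtain ⟨z, hz, hm⟩ : ∃ z : F, z ≠ 0 ∧ max ‖x‖ ‖y‖ = ‖z‖ := by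
      rcases max_choice ‖x‖ ‖y‖ with hm | hm
      · refine ⟨x, ?_, hm⟩
        rintro rfl
        have : y = 0 := by simpa using hm
        exact ha (by rw [hxy, this]; simp)
      · refine ⟨y, ?_, hm⟩
        rintro rfl
        have : x = 0 := by simpa using hm
        exact ha (by rw [hxy, this]; simp)
    obtain ⟨n, hn⟩ := hπ.exists_zpow hz
    refine ⟨n, ?_⟩
    rw [hm, hn, mul_comm, zpow_mul]
    norm_cast
  · rintro ⟨n, hn⟩
    have hp : π ^ n ≠ 0 := zpow_ne_zero _ hπ.ne_zero
    have hu : ‖a / (π ^ n) ^ 2‖ = 1 := by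
      rw [norm_div, hn, norm_pow, norm_zpow, mul_comm, zpow_mul]
      norm_cast
      exact div_self (pow_ne_zero 2 (zpow_ne_zero _ (norm_ne_zero_iff.2 hπ.ne_zero)))
    obtain ⟨x, y, hxy⟩ := exists_unramified_norm_eq h
      (u := ⟨a / (π ^ n) ^ 2, mem_unitBall.2 hu.le⟩)
      (fun h0 ↦ by rw [red_eq_zero_iff] at h0; exact absurd hu h0.ne)
    refine ⟨π ^ n * x, π ^ n * y, ?_⟩
    have := congrArg (Subtype.val) hxy
    simp only [AddMemClass.coe_add, MulMemClass.coe_mul, SubmonoidClass.coe_pow] at this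
    rw [eq_div_iff (pow_ne_zero 2 hp)] at this
    linear_combination -this

theorem not_isSquare_unramified_disc (h2 : (2 : F) ≠ 0) {c : unitBall F}
    (h : BinaryAnisotropic 1 1 (red c)) : ¬ IsSquare (1 - 4 * (c : F)) := by
  rintro ⟨r, hr⟩
  have := norm_unramified_norm h (r - 1) 2
  rw [show (r - 1) ^ 2 + (r - 1) * 2 + (c : F) * 2 ^ 2 = 0 by linear_combination -hr] at this
  rw [norm_zero, eq_comm, pow_eq_zero_iff two_ne_zero] at this
  have h' : ‖(2 : F)‖ ≤ 0 := (le_max_right _ _).trans this.le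
  exact h2 (norm_le_zero_iff.1 h')

/-- The unramified quadratic extension has a norm group of index two. -/
theorem exists_nonsquare_normIndexLeTwo [CompleteSpace F] [Finite (ballResidueField F)]
    (h2 : (2 : F) ≠ 0) {π : F} (hπ : IsNormUniformizer π) :
    ∃ d : F, d ≠ 0 ∧ ¬ IsSquare d ∧ NormIndexLeTwo d := by
  obtain ⟨c, hc⟩ := exists_binaryAnisotropic (ballResidueField F)
  obtain ⟨c, rfl⟩ := red_surjective c
  have hsq := not_isSquare_unramified_disc h2 hc
  refine ⟨1 - 4 * (c : F), fun h0 ↦ hsq (by rw [h0]; simp), hsq, fun a b ha hb hna hnb ↦ ?_⟩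
  rw [isNormValue_unramified_iff h2 hπ hc ha] at hna
  rw [isNormValue_unramified_iff h2 hπ hc hb] at hnb
  rw [isNormValue_unramified_iff h2 hπ hc (mul_ne_zero ha hb)]
  obtain ⟨m, hm⟩ := hπ.exists_zpow ha
  obtain ⟨n, hn⟩ := hπ.exists_zpow hb
  have hm' : ¬ Even m := fun ⟨k, hk⟩ ↦ hna ⟨k, by rw [hm, hk, two_mul]⟩
  have hn' : ¬ Even n := fun ⟨k, hk⟩ ↦ hnb ⟨k, by rw [hn, hk, two_mul]⟩
  rw [Int.not_even_iff_odd] at hm' hn'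
  obtain ⟨k, hk⟩ := hm'.add_odd hn'
  refine ⟨k, ?_⟩
  rw [norm_mul, hm, hn, ← zpow_add₀ (norm_ne_zero_iff.2 hπ.ne_zero), hk, two_mul]

end UnitBall

/-! ### Anisotropic quadratic forms over a complete field -/

section Lattice

open QuadraticMap

theorem map_smul_add_smul {F V : Type*} [Field F] [AddCommGroup V] [Module F V]
    (q : QuadraticForm F V) (a b : F) (x y : V) :
    q (a • x + b • y) = a ^ 2 * q x + a * b * polar q x y + b ^ 2 * q y := by
  rw [QuadraticMap.map_add (⇑q), QuadraticMap.map_smul, QuadraticMap.map_smul,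
    polar_smul_left, polar_smul_right]
  simp only [smul_eq_mul]
  ring

theorem anisotropic_smul {F V : Type*} [Field F] [AddCommGroup V] [Module F V]
    {q : QuadraticForm F V} (hq : q.Anisotropic) {c : F} (hc : c ≠ 0) : (c • q).Anisotropic := by
  intro x hx
  apply hq
  simpa [hc] using hx

theorem norm_map_smul {F V : Type*} [NormedField F] [AddCommGroup V] [Module F V]
    (q : QuadraticForm F V) (a : F) (x : V) : ‖q (a • x)‖ = ‖a‖ ^ 2 * ‖q x‖ := by
  rw [QuadraticMap.map_smul, smul_eq_mul, norm_mul, norm_mul, pow_two]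

theorem norm_map_smul_le {F V : Type*} [NormedField F] [AddCommGroup V] [Module F V]
    (q : QuadraticForm F V) {a : F} (ha : ‖a‖ ≤ 1) (x : V) :
    ‖q (a • x)‖ ≤ ‖q x‖ := by
  rw [norm_map_smul]
  exact mul_le_of_le_one_left (norm_nonneg _) (pow_le_one₀ (norm_nonneg _) ha)

variable {F V : Type*} [NormedField F] [IsUltrametricDist F] [CompleteSpace F]
  [AddCommGroup V] [Module F V] {q : QuadraticForm F V}

/-- A Cauchy–Schwarz inequality for an anisotropic form: if it failed, Hensel's lemma would give a
zero of `q` on the line through `x` in the direction `y`. -/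
theorem norm_polar_sq_le (hq : q.Anisotropic) (x y : V) :
    ‖polar q x y‖ ^ 2 ≤ ‖q x‖ * ‖q y‖ := by
  by_contra! hlt
  have hb : polar q x y ≠ 0 := by
    intro h0
    rw [h0] at hlt
    simp only [norm_zero, ne_eq, OfNat.ofNat_ne_zero, not_false_eq_true, zero_pow] at hlt
    exact absurd hlt (not_lt.2 (by positivity))
  have hy : q y ≠ 0 := by
    intro h0
    rw [hq _ h0] at hb
    simp at hb
  obtain ⟨s, hs, -⟩ := exists_root_of_norm_lt_one (c := q x * q y / polar q x y ^ 2) (by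
    rw [norm_div, norm_mul, norm_pow, div_lt_one (by positivity)]
    exact hlt)
  have hz : x + (polar q x y / q y * s) • y = 0 := by
    apply hq
    rw [← one_smul F x, map_smul_add_smul, one_smul]
    field_simp at hs ⊢
    linear_combination hs
  rw [add_eq_zero_iff_eq_neg, ← neg_smul] at hz
  generalize -(polar q x y / q y * s) = t at hz
  rw [hz, polar_smul_left, polar_self, QuadraticMap.map_smul] at hlt
  simp only [smul_eq_mul, norm_mul, nsmul_eq_mul] at hlt
  have h2 : ‖((2 : ℕ) : F)‖ ≤ 1 := norm_natCast_le 2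
  have h3 : (‖t‖ * (‖((2 : ℕ) : F)‖ * ‖q y‖)) ^ 2 ≤ ‖t‖ * ‖t‖ * ‖q y‖ * ‖q y‖ := by
    calc (‖t‖ * (‖((2 : ℕ) : F)‖ * ‖q y‖)) ^ 2 ≤ (‖t‖ * (1 * ‖q y‖)) ^ 2 := by gcongr
      _ = _ := by ring
  push_cast at h3
  exact absurd hlt (not_lt.2 h3)

/-- The square root of `‖q x‖` satisfies the ultrametric inequality. -/
theorem norm_map_add_le (hq : q.Anisotropic) (x y : V) :
    ‖q (x + y)‖ ≤ max ‖q x‖ ‖q y‖ := by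
  rw [QuadraticMap.map_add (⇑q)]
  refine (IsUltrametricDist.norm_add_le_max _ _).trans (max_le ?_ ?_)
  · exact IsUltrametricDist.norm_add_le_max _ _
  · refine abs_le_of_sq_le_sq' ?_ (by positivity) |>.2
    calc ‖polar q x y‖ ^ 2 ≤ ‖q x‖ * ‖q y‖ := norm_polar_sq_le hq x y
      _ ≤ max ‖q x‖ ‖q y‖ * max ‖q x‖ ‖q y‖ := by gcongr <;> simp
      _ = _ := by ring

theorem norm_map_add_lt (hq : q.Anisotropic) {x y : V} {r : ℝ} (hx : ‖q x‖ < r) (hy : ‖q y‖ < r) :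
    ‖q (x + y)‖ < r :=
  (norm_map_add_le hq x y).trans_lt (max_lt hx hy)

theorem norm_map_sub_lt (hq : q.Anisotropic) {x y : V} {r : ℝ} (hx : ‖q x‖ < r) (hy : ‖q y‖ < r) :
    ‖q (x - y)‖ < r := by
  rw [sub_eq_add_neg]
  exact norm_map_add_lt hq hx (by rwa [QuadraticMap.map_neg])

theorem norm_map_add_le_of_le (hq : q.Anisotropic) {x y : V} {r : ℝ} (hx : ‖q x‖ ≤ r)
    (hy : ‖q y‖ ≤ r) : ‖q (x + y)‖ ≤ r :=
  (norm_map_add_le hq x y).trans (max_le hx hy)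

theorem norm_map_sub_le_of_le (hq : q.Anisotropic) {x y : V} {r : ℝ} (hx : ‖q x‖ ≤ r)
    (hy : ‖q y‖ ≤ r) : ‖q (x - y)‖ ≤ r := by
  rw [sub_eq_add_neg]
  exact norm_map_add_le_of_le hq hx (by rwa [QuadraticMap.map_neg])

theorem norm_polar_le_one (hq : q.Anisotropic) {x y : V} (hx : ‖q x‖ ≤ 1) (hy : ‖q y‖ ≤ 1) :
    ‖polar q x y‖ ≤ 1 := by
  refine (sq_le_one_iff₀ (norm_nonneg _)).1 ((norm_polar_sq_le hq x y).trans ?_)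
  exact mul_le_one₀ hx (norm_nonneg _) hy

/-- The vectors `x` and `y` of the lattice `‖q ·‖ ≤ 1` are independent in the residue space, the
quotient of this lattice by `‖q ·‖ < 1`. -/
def ResiduallyIndependent (q : QuadraticForm F V) (x y : V) : Prop :=
  ∀ a b : F, ‖a‖ ≤ 1 → ‖b‖ ≤ 1 → ‖q (a • x + b • y)‖ < 1 → ‖a‖ < 1 ∧ ‖b‖ < 1

/-- Any three vectors of the lattice `‖q ·‖ ≤ 1` are dependent in the residue space, on which `q`
induces an anisotropic form over a finite field. -/
theorem exists_residual_relation [Finite (ballResidueField F)] (hq : q.Anisotropic) {x y z : V}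
    (hx : ‖q x‖ ≤ 1) (hy : ‖q y‖ ≤ 1) (hz : ‖q z‖ ≤ 1) :
    ∃ a b c : F, ‖a‖ ≤ 1 ∧ ‖b‖ ≤ 1 ∧ ‖c‖ ≤ 1 ∧ (‖a‖ = 1 ∨ ‖b‖ = 1 ∨ ‖c‖ = 1) ∧
      ‖q (a • x + b • y + c • z)‖ < 1 := by
  let X : unitBall F := ⟨q x, hx⟩
  let Y : unitBall F := ⟨q y, hy⟩
  let Z : unitBall F := ⟨q z, hz⟩
  let D : unitBall F := ⟨polar q x y, norm_polar_le_one hq hx hy⟩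
  let E : unitBall F := ⟨polar q x z, norm_polar_le_one hq hx hz⟩
  let G : unitBall F := ⟨polar q y z, norm_polar_le_one hq hy hz⟩
  obtain ⟨a, b, c, hne, h⟩ := exists_ternary_zero (red X) (red Y) (red Z) (red D) (red E) (red G)
  obtain ⟨a, rfl⟩ := red_surjective a
  obtain ⟨b, rfl⟩ := red_surjective b
  obtain ⟨c, rfl⟩ := red_surjective c
  refine ⟨a, b, c, a.2, b.2, c.2, ?_, ?_⟩
  · exact hne.imp norm_eq_one_of_red_ne_zero
      (Or.imp norm_eq_one_of_red_ne_zero norm_eq_one_of_red_ne_zero)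
  · have h' : red (X * a ^ 2 + Y * b ^ 2 + Z * c ^ 2 + D * a * b + E * a * c + G * b * c) = 0 := by
      simpa only [map_add, map_mul, map_pow] using h
    rw [red_eq_zero_iff] at h'
    convert h' using 2
    rw [QuadraticMap.map_add (⇑q), map_smul_add_smul, polar_add_left, polar_smul_left, polar_smul_left,
      polar_smul_right, polar_smul_right, QuadraticMap.map_smul]
    simp only [smul_eq_mul, X, Y, Z, D, E, G, AddMemClass.coe_add, MulMemClass.coe_mul,
      SubmonoidClass.coe_pow]
    ring

/-- The residue space has dimension at most two. -/
theorem exists_residual_generators [Finite (ballResidueField F)] (hq : q.Anisotropic) :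
    ∃ x y : V, ‖q x‖ ≤ 1 ∧ ‖q y‖ ≤ 1 ∧
      (∀ z, ‖q z‖ ≤ 1 → ∃ a b : F, ‖a‖ ≤ 1 ∧ ‖b‖ ≤ 1 ∧ ‖q (z - (a • x + b • y))‖ < 1) ∧
      (x ≠ 0 → y ≠ 0 → ResiduallyIndependent q x y) := by
  by_cases h₁ : ∀ z, ‖q z‖ ≤ 1 → ‖q z‖ < 1
  · exact ⟨0, 0, by simp, by simp, fun z hz ↦ ⟨0, 0, by simp, by simp, by simpa using h₁ z hz⟩,
      fun h ↦ absurd rfl h⟩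
  push Not at h₁
  obtain ⟨x, hx, hx'⟩ := h₁
  by_cases h₂ : ∀ z, ‖q z‖ ≤ 1 → ∃ a : F, ‖a‖ ≤ 1 ∧ ‖q (z - a • x)‖ < 1
  · refine ⟨x, 0, hx, by simp, fun z hz ↦ ?_, fun _ h ↦ absurd rfl h⟩
    obtain ⟨a, ha, h⟩ := h₂ z hz
    exact ⟨a, 0, ha, by simp, by simpa using h⟩
  push Not at h₂
  obtain ⟨y, hy, hy'⟩ := h₂
  have hind : ResiduallyIndependent q x y := by
    intro a b ha hb h
    have hb1 : ‖b‖ < 1 := by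
      by_contra hb1
      have hb1 : ‖b‖ = 1 := le_antisymm hb (not_lt.1 hb1)
      have hb0 : b ≠ 0 := by rintro rfl; simp at hb1
      refine absurd ?_ (not_lt.2 (hy' (-(b⁻¹ * a)) (by simpa [hb1] using ha)))
      have : y - (-(b⁻¹ * a)) • x = b⁻¹ • (a • x + b • y) := by
        rw [smul_add, smul_smul, smul_smul, inv_mul_cancel₀ hb0, neg_smul, one_smul,
          sub_neg_eq_add, add_comm]
      rw [this, norm_map_smul, norm_inv, hb1]
      simpa using h
    refine ⟨?_, hb1⟩
    by_contra ha1
    have ha1 : ‖a‖ = 1 := le_antisymm ha (not_lt.1 ha1)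
    have hby : ‖q (b • y)‖ < 1 := by
      rw [norm_map_smul]
      nlinarith [norm_nonneg b, norm_nonneg (q y)]
    have := norm_map_sub_lt hq h hby
    rw [add_sub_cancel_right, norm_map_smul, ha1] at this
    linarith
  refine ⟨x, y, hx, hy, fun z hz ↦ ?_, fun _ _ ↦ hind⟩
  obtain ⟨a, b, c, ha, hb, hc, h1, h⟩ := exists_residual_relation hq hx hy hz
  by_cases hc1 : ‖c‖ < 1
  · have hcz : ‖q (c • z)‖ < 1 := by
      rw [norm_map_smul]
      nlinarith [norm_nonneg c, norm_nonneg (q z)]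
    have := norm_map_sub_lt hq h hcz
    rw [add_sub_cancel_right] at this
    obtain ⟨ha1, hb1⟩ := hind a b ha hb this
    rcases h1 with h1 | h1 | h1 <;> linarith
  · have hc1 : ‖c‖ = 1 := le_antisymm hc (not_lt.1 hc1)
    have hc0 : c ≠ 0 := by rintro rfl; simp at hc1
    refine ⟨-(c⁻¹ * a), -(c⁻¹ * b), by simpa [hc1] using ha, by simpa [hc1] using hb, ?_⟩
    have : z - (-(c⁻¹ * a) • x + -(c⁻¹ * b) • y) = c⁻¹ • (a • x + b • y + c • z) := by
      simp only [smul_add, smul_smul, inv_mul_cancel₀ hc0, neg_smul, one_smul]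
      abel
    rw [this, norm_map_smul, norm_inv, hc1]
    simpa using h

/-- The reduction of `q` on a residually independent pair is an anisotropic binary form. -/
theorem ResiduallyIndependent.exists_coeff (hq : q.Anisotropic) {x y : V}
    (h : ResiduallyIndependent q x y) (hx : ‖q x‖ ≤ 1) (hy : ‖q y‖ ≤ 1) :
    ∃ A B C : unitBall F, (A : F) = q x ∧ (B : F) = polar q x y ∧ (C : F) = q y ∧
      BinaryAnisotropic (red A) (red B) (red C) := by
  refine ⟨⟨q x, hx⟩, ⟨polar q x y, norm_polar_le_one hq hx hy⟩, ⟨q y, hy⟩, rfl, rfl, rfl, ?_⟩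
  intro a b hab
  obtain ⟨a, rfl⟩ := red_surjective a
  obtain ⟨b, rfl⟩ := red_surjective b
  rw [red_eq_zero_iff, red_eq_zero_iff]
  refine h a b a.2 b.2 ?_
  rw [← map_pow, ← map_pow, ← map_mul, ← map_mul, ← map_mul, ← map_mul, ← map_add, ← map_add,
    red_eq_zero_iff] at hab
  convert hab using 2
  rw [map_smul_add_smul]
  simp only [AddMemClass.coe_add, MulMemClass.coe_mul, SubmonoidClass.coe_pow]
  ring

/-- The lattice `‖q ·‖ ≤ 1` is generated, up to arbitrarily small vectors, by lifts of generators
of the residue spaces of `q` and of `π⁻¹ q`; therefore such lifts span the whole space. -/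
theorem span_eq_top_of_generators [FiniteDimensional F V] (h2 : (2 : F) ≠ 0) {π : F}
    (hπ : IsNormUniformizer π) (hq : q.Anisotropic) {e₁ e₂ f₁ f₂ : V}
    (he : ∀ z, ‖q z‖ ≤ 1 → ∃ a b : F, ‖a‖ ≤ 1 ∧ ‖b‖ ≤ 1 ∧ ‖q (z - (a • e₁ + b • e₂))‖ < 1)
    (hf : ∀ z, ‖(π⁻¹ • q) z‖ ≤ 1 →
      ∃ a b : F, ‖a‖ ≤ 1 ∧ ‖b‖ ≤ 1 ∧ ‖(π⁻¹ • q) (z - (a • f₁ + b • f₂))‖ < 1) :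
    Submodule.span F {e₁, e₂, f₁, f₂} = ⊤ := by
  have hπ0 : 0 < ‖π‖ := norm_pos_iff.2 hπ.ne_zero
  -- one step of the approximation
  have step : ∀ z, ‖q z‖ ≤ 1 → ∃ m ∈ Submodule.span F {e₁, e₂, f₁, f₂}, ∃ z', ‖q z'‖ ≤ 1 ∧
      z = m + π • z' := by
    intro z hz
    obtain ⟨a, b, -, -, h₁⟩ := he z hz
    obtain ⟨c, d, -, -, h₂⟩ := hf (z - (a • e₁ + b • e₂)) (by
      rw [_root_.smul_apply, smul_eq_mul, norm_mul, norm_inv,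
        inv_mul_le_one₀ hπ0]
      exact hπ.norm_le _ h₁)
    set w := z - (a • e₁ + b • e₂) - (c • f₁ + d • f₂) with hw
    refine ⟨(a • e₁ + b • e₂) + (c • f₁ + d • f₂), ?_, π⁻¹ • w, ?_, ?_⟩
    · refine add_mem (add_mem ?_ ?_) (add_mem ?_ ?_) <;>
        exact Submodule.smul_mem _ _ (Submodule.subset_span (by simp))
    · have h₃ := hπ.norm_le _ h₂
      rw [_root_.smul_apply, smul_eq_mul, norm_mul, norm_inv, inv_mul_le_iff₀ hπ0] at h₃
      rw [norm_map_smul, norm_inv, inv_pow, inv_mul_le_one₀ (by positivity), pow_two]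
      exact h₃
    · rw [smul_inv_smul₀ hπ.ne_zero, hw]
      abel
  by_contra hne
  -- a linear form vanishing on the span is bounded on the lattice, because it is `polar q u`
  obtain ⟨ℓ, hℓ, hle⟩ := Submodule.exists_le_ker_of_lt_top _ (lt_top_iff_ne_top.2 hne)
  have hnd : (polarBilin q).Nondegenerate := by
    have hker : ∀ x, (∀ y, polarBilin q x y = 0) → x = 0 := by
      intro x hx
      apply hq
      have := hx x
      rw [polarBilin_apply_apply, polar_self, nsmul_eq_mul] at this
      simpa [h2] using this
    refine ⟨hker, fun x hx ↦ hker x fun y ↦ ?_⟩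
    rw [polarBilin_apply_apply, polar_comm]
    exact hx y
  let u := (LinearMap.BilinForm.toDual (polarBilin q) hnd).symm ℓ
  have hu : ∀ z, ℓ z = polar q u z := fun z ↦ by
    have := LinearMap.BilinForm.apply_toDual_symm_apply (hB := hnd) (f := ℓ) z
    rw [← this, polarBilin_apply_apply]
  have hbound : ∀ n : ℕ, ∀ z, ‖q z‖ ≤ 1 → ‖ℓ z‖ ^ 2 ≤ (‖π‖ ^ 2) ^ n * ‖q u‖ := by
    intro n
    induction n with
    | zero =>
      intro z hz
      rw [hu, pow_zero, one_mul]
      exact (norm_polar_sq_le hq u z).trans (mul_le_of_le_one_right (norm_nonneg _) hz)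
    | succ n ih =>
      intro z hz
      obtain ⟨m, hm, z', hz', rfl⟩ := step z hz
      have hm0 : ℓ m = 0 := hle hm
      rw [map_add, hm0, zero_add, map_smul, smul_eq_mul, norm_mul, mul_pow,
        pow_succ' (‖π‖ ^ 2), mul_assoc]
      exact mul_le_mul_of_nonneg_left (ih z' hz') (by positivity)
  have hzero : ∀ z, ‖q z‖ ≤ 1 → ℓ z = 0 := by
    intro z hz
    have hlim : Filter.Tendsto (fun n : ℕ ↦ (‖π‖ ^ 2) ^ n * ‖q u‖) Filter.atTop (nhds 0) := by
      have := (tendsto_pow_atTop_nhds_zero_of_lt_one (r := ‖π‖ ^ 2) (by positivity)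
        (pow_lt_one₀ hπ0.le hπ.norm_lt_one two_ne_zero)).mul_const ‖q u‖
      simpa using this
    have : ‖ℓ z‖ ^ 2 ≤ 0 := ge_of_tendsto' hlim fun n ↦ hbound n z hz
    have : ‖ℓ z‖ = 0 := by simpa using le_antisymm this (by positivity)
    simpa using this
  apply hℓ
  ext z
  obtain ⟨n, hn⟩ := exists_pow_lt_of_lt_one (x := (‖q z‖ + 1)⁻¹) (y := ‖π‖) (by positivity)
    hπ.norm_lt_one
  have hpn : ‖π‖ ^ n ≤ 1 := pow_le_one₀ hπ0.le hπ.norm_lt_one.le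
  have hsmall : ‖q (π ^ n • z)‖ ≤ 1 := by
    rw [norm_map_smul, norm_pow]
    calc (‖π‖ ^ n) ^ 2 * ‖q z‖ ≤ ‖π‖ ^ n * ‖q z‖ := by
          gcongr
          exact pow_le_of_le_one (by positivity) hpn two_ne_zero
      _ ≤ (‖q z‖ + 1)⁻¹ * (‖q z‖ + 1) := by
          gcongr
          linarith
      _ = 1 := inv_mul_cancel₀ (by positivity)
  have := hzero _ hsmall
  rw [map_smul, smul_eq_mul] at this
  simpa [hπ.ne_zero] using this

/-- Lifts to `V` of bases of the residue spaces of `q` and of `π⁻¹ q`, both of which have dimension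
two when `V` has dimension four. -/
theorem exists_residual_bases [Finite (ballResidueField F)] [FiniteDimensional F V]
    (h2 : (2 : F) ≠ 0) {π : F} (hπ : IsNormUniformizer π) (hq : q.Anisotropic)
    (hV : Module.finrank F V = 4) :
    ∃ e₁ e₂ f₁ f₂ : V, ‖q e₁‖ ≤ 1 ∧ ‖q e₂‖ ≤ 1 ∧ ‖(π⁻¹ • q) f₁‖ ≤ 1 ∧ ‖(π⁻¹ • q) f₂‖ ≤ 1 ∧
      ResiduallyIndependent q e₁ e₂ ∧ ResiduallyIndependent (π⁻¹ • q) f₁ f₂ := by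
  obtain ⟨e₁, e₂, he₁, he₂, he, hei⟩ := exists_residual_generators hq
  obtain ⟨f₁, f₂, hf₁, hf₂, hf, hfi⟩ := exists_residual_generators
    (anisotropic_smul hq (inv_ne_zero hπ.ne_zero))
  have hspan := span_eq_top_of_generators h2 hπ hq he hf
  have hli : LinearIndependent F ![e₁, e₂, f₁, f₂] := by
    refine linearIndependent_of_top_le_span_of_card_eq_finrank ?_ (by simp [hV])
    rw [← hspan]
    refine Submodule.span_mono ?_
    rintro x (rfl | rfl | rfl | rfl)
    exacts [⟨0, rfl⟩, ⟨1, rfl⟩, ⟨2, rfl⟩, ⟨3, rfl⟩]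
  exact ⟨e₁, e₂, f₁, f₂, he₁, he₂, hf₁, hf₂, hei (hli.ne_zero 0) (hli.ne_zero 1),
    hfi (hli.ne_zero 2) (hli.ne_zero 3)⟩

/-- The orthogonal projection of a vector `f` with `‖q f‖ ≤ ‖π‖` away from a plane with unit
discriminant changes it only by a vector `g` with `‖q g‖ < ‖π‖`. -/
theorem exists_orthogonal_correction {π : F} (hπ : IsNormUniformizer π) (hq : q.Anisotropic)
    {e₁ e₂ f : V} (he₁ : ‖q e₁‖ ≤ 1) (he₂ : ‖q e₂‖ ≤ 1) (hf : ‖q f‖ ≤ ‖π‖)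
    (hD : ‖polar q e₁ e₂ ^ 2 - 4 * q e₁ * q e₂‖ = 1) :
    ∃ g, ‖q g‖ < ‖π‖ ∧ polar q e₁ (f - g) = 0 ∧ polar q e₂ (f - g) = 0 := by
  have hπ0 : 0 < ‖π‖ := norm_pos_iff.2 hπ.ne_zero
  have hsmall : ∀ e, ‖q e‖ ≤ 1 → ‖polar q e f‖ ≤ ‖π‖ := by
    intro e he
    refine hπ.norm_le _ ((sq_lt_one_iff₀ (norm_nonneg _)).1 ?_)
    refine (norm_polar_sq_le hq e f).trans_lt ?_
    exact (mul_le_of_le_one_left (norm_nonneg _) he).trans_lt (hf.trans_lt hπ.norm_lt_one)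
  set A := q e₁
  set C := q e₂
  set B := polar q e₁ e₂
  set D := B ^ 2 - 4 * A * C with hDdef
  have hD0 : D ≠ 0 := by
    intro h0
    rw [h0] at hD
    simp at hD
  have hB : ‖B‖ ≤ 1 := norm_polar_le_one hq he₁ he₂
  have h2 : ‖(2 : F)‖ ≤ 1 := by exact_mod_cast norm_natCast_le (F := F) 2
  set p := polar q e₁ f
  set r := polar q e₂ f
  -- Cramer's rule
  have hlin : ∀ s t : F, ‖s‖ ≤ 1 → ‖t‖ ≤ 1 → ‖(s * p - t * r) / D‖ ≤ ‖π‖ := by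
    intro s t hs ht
    rw [norm_div, hD, div_one, sub_eq_add_neg]
    refine (IsUltrametricDist.norm_add_le_max _ _).trans (max_le ?_ ?_)
    · rw [norm_mul]
      exact (mul_le_of_le_one_left (norm_nonneg _) hs).trans (hsmall _ he₁)
    · rw [norm_neg, norm_mul]
      exact (mul_le_of_le_one_left (norm_nonneg _) ht).trans (hsmall _ he₂)
  have h2A : ‖-2 * A‖ ≤ 1 := by
    rw [norm_mul, norm_neg]
    exact mul_le_one₀ h2 (norm_nonneg _) he₁
  have h2C : ‖-2 * C‖ ≤ 1 := by
    rw [norm_mul, norm_neg]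
    exact mul_le_one₀ h2 (norm_nonneg _) he₂
  refine ⟨((-2 * C * p - -B * r) / D) • e₁ + ((B * p - -(-2 * A) * r) / D) • e₂, ?_, ?_, ?_⟩
  · have hsq : ‖π‖ ^ 2 < ‖π‖ := by nlinarith [hπ.norm_lt_one]
    refine norm_map_add_lt hq ?_ ?_
    · refine lt_of_le_of_lt ?_ hsq
      rw [norm_map_smul]
      refine (mul_le_of_le_one_right (by positivity) he₁).trans ?_
      gcongr
      exact hlin _ _ h2C (by rwa [norm_neg])
    · refine lt_of_le_of_lt ?_ hsq
      rw [norm_map_smul]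
      refine (mul_le_of_le_one_right (by positivity) he₂).trans ?_
      gcongr
      exact hlin _ _ hB (by rwa [norm_neg])
  · rw [polar_sub_right, polar_add_right, polar_smul_right, polar_smul_right, polar_self]
    simp only [smul_eq_mul, nsmul_eq_mul, Nat.cast_ofNat]
    change p - (_ * (2 * A) + _ * B) = 0
    field_simp
    rw [hDdef]
    ring
  · rw [polar_sub_right, polar_add_right, polar_smul_right, polar_smul_right, polar_self,
      polar_comm q e₂ e₁]
    simp only [smul_eq_mul, nsmul_eq_mul, Nat.cast_ofNat]
    change r - (_ * B + _ * (2 * C)) = 0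
    field_simp
    rw [hDdef]
    ring

/-- Residual independence depends only on the classes of the vectors in the residue space. -/
theorem ResiduallyIndependent.sub (hq : q.Anisotropic) {x y g h : V}
    (hxy : ResiduallyIndependent q x y) (hg : ‖q g‖ < 1) (hh : ‖q h‖ < 1) :
    ResiduallyIndependent q (x - g) (y - h) := by
  intro a b ha hb hab
  refine hxy a b ha hb ?_
  have : a • x + b • y = (a • (x - g) + b • (y - h)) + (a • g + b • h) := by
    simp only [smul_sub]
    abel
  rw [this]
  exact norm_map_add_lt hq hab (norm_map_add_lt hq ((norm_map_smul_le q ha g).trans_lt hg)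
    ((norm_map_smul_le q hb h).trans_lt hh))

/-- The Gram determinant of an orthogonal sum of two planes in the space of a diagonal quaternary
form. -/
theorem disc_mul_disc_eq {F : Type*} [Field F] (a : Fin 4 → F) {e₁ e₂ f₁ f₂ : Fin 4 → F}
    (q : QuadraticForm F (Fin 4 → F)) (hq : q = QuadraticMap.weightedSumSquares F a)
    (h₁₁ : polar q e₁ f₁ = 0) (h₁₂ : polar q e₁ f₂ = 0) (h₂₁ : polar q e₂ f₁ = 0)
    (h₂₂ : polar q e₂ f₂ = 0) :
    ∃ m : F, (polar q e₁ e₂ ^ 2 - 4 * q e₁ * q e₂) * (polar q f₁ f₂ ^ 2 - 4 * q f₁ * q f₂) =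
      a 0 * a 1 * a 2 * a 3 * m ^ 2 := by
  let v : Fin 4 → Fin 4 → F := ![e₁, e₂, f₁, f₂]
  let M : Matrix (Fin 4) (Fin 4) F := Matrix.of v
  have hpol : ∀ x y, polar q x y = ∑ i, 2 * a i * x i * y i := by
    intro x y
    rw [polar, hq]
    simp only [QuadraticMap.weightedSumSquares_apply, Fin.sum_univ_four, Pi.add_apply, smul_eq_mul]
    ring
  have hG : M * Matrix.diagonal (fun i ↦ 2 * a i) * M.transpose =
      Matrix.of fun i j ↦ polar q (v i) (v j) := by
    ext i j
    rw [Matrix.mul_apply, Matrix.of_apply, hpol]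
    refine Finset.sum_congr rfl fun l _ ↦ ?_
    rw [Matrix.mul_diagonal, Matrix.transpose_apply]
    change v i l * (2 * a l) * v j l = _
    ring
  have hdet := congrArg Matrix.det hG
  rw [Matrix.det_mul, Matrix.det_mul, Matrix.det_diagonal, Matrix.det_transpose] at hdet
  refine ⟨4 * M.det, ?_⟩
  have hG' : (Matrix.of fun i j ↦ polar q (v i) (v j)) =
      !![2 * q e₁, polar q e₁ e₂, 0, 0; polar q e₁ e₂, 2 * q e₂, 0, 0;
        0, 0, 2 * q f₁, polar q f₁ f₂; 0, 0, polar q f₁ f₂, 2 * q f₂] := by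
    ext i j
    fin_cases i <;> fin_cases j <;>
      simp [v, h₁₁, h₁₂, h₂₁, h₂₂, polar_self, polar_comm q f₁ e₁, polar_comm q f₁ e₂,
        polar_comm q f₂ e₁, polar_comm q f₂ e₂, polar_comm q f₂ f₁, polar_comm q e₂ e₁]
  have hblock : ∀ A B C D E G : F,
      !![A, B, 0, 0; B, C, 0, 0; 0, 0, D, E; 0, 0, E, G].det =
        (A * C - B ^ 2) * (D * G - E ^ 2) := by
    intro A B C D E G
    simp [Matrix.det_succ_row_zero, Fin.sum_univ_succ, Fin.succAbove]
    ring
  rw [hG', hblock, Fin.prod_univ_four] at hdet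
  linear_combination -hdet

/-- An anisotropic diagonal quaternary form has square discriminant: it is an orthogonal sum of two
planes, which are, up to scaling, norm forms of the unramified quadratic extension. -/
theorem quaternaryFormsIsotropic_of_isNormUniformizer [Finite (ballResidueField F)]
    (h2 : (2 : F) ≠ 0) {π : F} (hπ : IsNormUniformizer π) : QuaternaryFormsIsotropic F := by
  intro a b c d ha hb hc hd hsq
  by_contra! hani
  apply hsq
  let q := QuadraticMap.weightedSumSquares F ![a, b, c, d]
  have hq : q.Anisotropic := by
    intro x hx
    by_contra hx0
    refine hani (x 0) (x 1) (x 2) (x 3) ?_ ?_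
    · by_contra! h0
      apply hx0
      ext i
      fin_cases i <;> simp [h0]
    · simpa [q, QuadraticMap.weightedSumSquares_apply, Fin.sum_univ_four, pow_two] using hx
  have hq' : (π⁻¹ • q).Anisotropic := anisotropic_smul hq (inv_ne_zero hπ.ne_zero)
  have hπ0 : 0 < ‖π‖ := norm_pos_iff.2 hπ.ne_zero
  have hsc : ∀ x, ‖(π⁻¹ • q) x‖ = ‖π‖⁻¹ * ‖q x‖ := fun x ↦ by
    rw [_root_.smul_apply, smul_eq_mul, norm_mul, norm_inv]
  obtain ⟨e₁, e₂, f₁, f₂, he₁, he₂, hf₁, hf₂, he, hf⟩ := exists_residual_bases h2 hπ hq (by simp)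
  obtain ⟨A, B, C, hA, hB, hC, hABC⟩ := he.exists_coeff hq he₁ he₂
  have hD : ‖polar q e₁ e₂ ^ 2 - 4 * q e₁ * q e₂‖ = 1 := by
    rw [← hA, ← hB, ← hC]
    refine norm_eq_one_of_red_ne_zero (x := B ^ 2 - 4 * A * C) ?_
    simpa only [map_sub, map_mul, map_pow, map_ofNat] using hABC.disc_ne_zero
  have hπf : ∀ x, ‖(π⁻¹ • q) x‖ ≤ 1 → ‖q x‖ ≤ ‖π‖ := fun x hx ↦ by
    rwa [hsc, inv_mul_le_one₀ hπ0] at hx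
  obtain ⟨g₁, hg₁, h₁₁, h₂₁⟩ := exists_orthogonal_correction hπ hq he₁ he₂ (hπf _ hf₁) hD
  obtain ⟨g₂, hg₂, h₁₂, h₂₂⟩ := exists_orthogonal_correction hπ hq he₁ he₂ (hπf _ hf₂) hD
  have hπg : ∀ x, ‖q x‖ < ‖π‖ → ‖(π⁻¹ • q) x‖ < 1 := fun x hx ↦ by
    rwa [hsc, inv_mul_lt_one₀ hπ0]
  obtain ⟨A', B', C', hA', hB', hC', hABC'⟩ := (hf.sub hq' (hπg _ hg₁) (hπg _ hg₂)).exists_coeff hq'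
    (norm_map_sub_le_of_le hq' hf₁ (hπg _ hg₁).le) (norm_map_sub_le_of_le hq' hf₂ (hπg _ hg₂).le)
  have hD' : ‖(B' : F) ^ 2 - 4 * A' * C'‖ = 1 := by
    refine norm_eq_one_of_red_ne_zero (x := B' ^ 2 - 4 * A' * C') ?_
    simpa only [map_sub, map_mul, map_pow, map_ofNat] using hABC'.disc_ne_zero
  obtain ⟨r, hr⟩ := isSquare_disc_mul_disc hABC hABC'
  obtain ⟨m, hm⟩ := disc_mul_disc_eq ![a, b, c, d] q rfl h₁₁ h₁₂ h₂₁ h₂₂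
  set x₁ := f₁ - g₁
  set x₂ := f₂ - g₂
  have e₁' : q x₁ = π * A' := by
    rw [hA', _root_.smul_apply, smul_eq_mul, mul_inv_cancel_left₀ hπ.ne_zero]
  have e₂' : q x₂ = π * C' := by
    rw [hC', _root_.smul_apply, smul_eq_mul, mul_inv_cancel_left₀ hπ.ne_zero]
  have e₃' : polar q x₁ x₂ = π * B' := by
    rw [hB', polar, polar]
    simp only [_root_.smul_apply, smul_eq_mul]
    field_simp [hπ.ne_zero]
  have hr' := congrArg (Subtype.val) hr
  simp only [AddSubgroupClass.coe_sub, MulMemClass.coe_mul, SubmonoidClass.coe_pow] at hr'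
  change ((B : F) ^ 2 - 4 * A * C) * ((B' : F) ^ 2 - 4 * A' * C') = r ^ 2 at hr'
  rw [← hA, ← hB, ← hC] at hm hD
  rw [e₁', e₂', e₃'] at hm
  have hm' : (π * r) ^ 2 = a * b * c * d * m ^ 2 := by
    have : ![a, b, c, d] 0 * ![a, b, c, d] 1 * ![a, b, c, d] 2 * ![a, b, c, d] 3 =
      a * b * c * d := rfl
    rw [this] at hm
    linear_combination hm - π ^ 2 * hr'
  have hm0 : m ≠ 0 := by
    rintro rfl
    have h0 : π * (r : F) = 0 := by simpa using hm'
    have hr0 : (r : F) = 0 := (mul_eq_zero.1 h0).resolve_left hπ.ne_zero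
    rw [hr0] at hr'
    have := congrArg norm hr'
    rw [norm_mul, hD, hD'] at this
    simp at this
  refine ⟨π * r / m, ?_⟩
  field_simp
  linear_combination -hm'

end Lattice

/-! ### Absolute values of global fields are discrete with finite residue field -/

section Discrete

open Polynomial

/-- Two distinct nonzero terms of a vanishing ultrametric sum have the same norm. -/
theorem exists_coeff_norm_eq {A K : Type*} [CommRing A] [NormedField K] [IsUltrametricDist K]
    {φ : A →+* K} (hφ : Function.Injective φ) {P : A[X]} (hP : P ≠ 0) {x : K} (hx : x ≠ 0)
    (h : P.eval₂ φ x = 0) :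
    ∃ i j : ℕ, i < j ∧ j ≤ P.natDegree ∧ P.coeff i ≠ 0 ∧ P.coeff j ≠ 0 ∧
      ‖φ (P.coeff i)‖ * ‖x‖ ^ i = ‖φ (P.coeff j)‖ * ‖x‖ ^ j := by
  by_contra! hc
  have hpair : Set.Pairwise (P.support : Set ℕ)
      (fun i j ↦ ‖φ (P.coeff i) * x ^ i‖ ≠ ‖φ (P.coeff j) * x ^ j‖) := by
    intro i hi j hj hij
    simp only [Finset.mem_coe, mem_support_iff] at hi hj
    rw [norm_mul, norm_mul, norm_pow, norm_pow]
    rcases lt_or_gt_of_ne hij with hlt | hlt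
    · exact hc i j hlt (le_natDegree_of_ne_zero hj) hi hj
    · exact (hc j i hlt (le_natDegree_of_ne_zero hi) hj hi).symm
  have hne : P.support.Nonempty := support_nonempty.2 hP
  have hsum := IsUltrametricDist.norm_sum_eq_sup'_of_pairwise_ne hne hpair
  rw [eval₂_eq_sum, sum_def] at h
  rw [h, norm_zero] at hsum
  obtain ⟨i, hi⟩ := hne
  have hle := Finset.le_sup' (fun i ↦ ‖φ (P.coeff i) * x ^ i‖) hi
  rw [← hsum, norm_le_zero_iff, mul_eq_zero] at hle
  rcases hle with h0 | h0
  · exact mem_support_iff.1 hi ((map_eq_zero_iff φ hφ).1 h0)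
  · exact pow_ne_zero _ hx h0

/-- The ring `A` embeds into the unit ball of the normed field `K`, and all elements
of `K` are algebraic over `A`, of degree at most `n`. For a global field, `A` is `ℤ`, or a polynomial
ring over a prime field, whose variable is sent to `t` or to `t⁻¹`. -/
structure IsBoundedBase {A K : Type*} [CommRing A] [NormedField K] (φ : A →+* K) (n : ℕ) :
    Prop where
  injective : Function.Injective φ
  norm_le_one : ∀ a, ‖φ a‖ ≤ 1
  exists_polynomial : ∀ x : K, ∃ P : A[X], P ≠ 0 ∧ P.natDegree ≤ n ∧ P.eval₂ φ x = 0

namespace IsBoundedBase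

variable {A K : Type*} [CommRing A] [NormedField K] {φ : A →+* K} {n : ℕ}

theorem not_isUnit_generator {p : A} (hp : ∀ a, ‖φ a‖ < 1 ↔ p ∣ a) : ¬ IsUnit p := by
  intro hu
  have := (hp 1).2 hu.dvd
  simp at this

variable [IsPrincipalIdealRing A]

/-- The elements of `A` of norm less than one are the multiples of an element `p ≠ 0`. -/
theorem exists_generator [IsUltrametricDist K] (h : IsBoundedBase φ n) (hK : ∃ x : K, x ≠ 0 ∧ ‖x‖ ≠ 1) :
    ∃ p : A, p ≠ 0 ∧ ∀ a, ‖φ a‖ < 1 ↔ p ∣ a := by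
  let P : Ideal A :=
    { carrier := {a | ‖φ a‖ < 1}
      zero_mem' := by simp
      add_mem' := fun {a b} ha hb ↦ by
        simp only [Set.mem_ofPred_eq, map_add] at ha hb ⊢
        exact (IsUltrametricDist.norm_add_le_max _ _).trans_lt (max_lt ha hb)
      smul_mem' := fun c a ha ↦ by
        simp only [Set.mem_ofPred_eq, smul_eq_mul, map_mul, norm_mul] at ha ⊢
        exact (mul_le_of_le_one_left (norm_nonneg _) (h.norm_le_one c)).trans_lt ha }
  obtain ⟨p, hp⟩ := (IsPrincipalIdealRing.principal P).principal
  have hmem : ∀ a, ‖φ a‖ < 1 ↔ p ∣ a := fun a ↦ by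
    rw [← Ideal.mem_span_singleton, Ideal.span, ← hp]
    rfl
  refine ⟨p, ?_, hmem⟩
  rintro rfl
  have hone : ∀ a, a ≠ 0 → ‖φ a‖ = 1 := fun a ha ↦
    le_antisymm (h.norm_le_one a) (not_lt.1 fun hlt ↦ ha (zero_dvd_iff.1 ((hmem a).1 hlt)))
  obtain ⟨x, hx, hx1⟩ := hK
  obtain ⟨Q, hQ, -, hQx⟩ := h.exists_polynomial x
  obtain ⟨i, j, hij, -, hi, hj, heq⟩ := exists_coeff_norm_eq h.injective hQ hx hQx
  rw [hone _ hi, hone _ hj, one_mul, one_mul] at heq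
  exact hij.ne ((pow_right_inj₀ (norm_pos_iff.2 hx) hx1).1 heq)

variable [IsDomain A]

/-- The values on `A` are powers of the value of the generator `p`. -/
theorem exists_norm_eq_pow (h : IsBoundedBase φ n) {p : A} (hp : ∀ a, ‖φ a‖ < 1 ↔ p ∣ a) {a : A}
    (ha : a ≠ 0) : ∃ m : ℕ, ‖φ a‖ = ‖φ p‖ ^ m := by
  obtain ⟨m, b, hb, rfl⟩ := WfDvdMonoid.max_power_factor' ha (not_isUnit_generator hp)
  refine ⟨m, ?_⟩
  rw [map_mul, map_pow, norm_mul, norm_pow,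
    le_antisymm (h.norm_le_one b) (not_lt.1 fun hlt ↦ hb ((hp b).1 hlt)), mul_one]

/-- The value group is discrete: its `n!`-th powers lie in the value group of the fractions of `A`,
which is generated by the value of `p`. -/
theorem exists_isNormUniformizer [IsUltrametricDist K] (h : IsBoundedBase φ n) (hK : ∃ x : K, x ≠ 0 ∧ ‖x‖ ≠ 1) :
    ∃ π : K, IsNormUniformizer π := by
  obtain ⟨p, hp0, hp⟩ := h.exists_generator hK
  have hρ0 : 0 < ‖φ p‖ := norm_pos_iff.2 ((map_ne_zero_iff φ h.injective).2 hp0)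
  have hρ1 : ‖φ p‖ < 1 := (hp p).2 dvd_rfl
  have hN : n.factorial ≠ 0 := n.factorial_ne_zero
  have key : ∀ x : K, x ≠ 0 → ∃ k : ℤ, ‖x‖ ^ n.factorial = ‖φ p‖ ^ k := by
    intro x hx
    obtain ⟨Q, hQ, hQn, hQx⟩ := h.exists_polynomial x
    obtain ⟨i, j, hij, hjn, hi, hj, heq⟩ := exists_coeff_norm_eq h.injective hQ hx hQx
    obtain ⟨a, ha⟩ := h.exists_norm_eq_pow hp hi
    obtain ⟨b, hb⟩ := h.exists_norm_eq_pow hp hj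
    obtain ⟨d, rfl⟩ := Nat.exists_eq_add_of_lt hij
    obtain ⟨c, hc⟩ : d + 1 ∣ n.factorial := Nat.dvd_factorial (by omega) (by omega)
    have hxd : ‖x‖ ^ (d + 1) = ‖φ p‖ ^ ((a : ℤ) - b) := by
      rw [ha, hb, add_assoc, pow_add _ i, mul_comm, mul_left_comm] at heq
      have := mul_left_cancel₀ (pow_ne_zero _ (norm_ne_zero_iff.2 hx)) heq
      rw [zpow_sub₀ hρ0.ne', zpow_natCast, zpow_natCast, this, mul_div_cancel_left₀]
      exact pow_ne_zero _ hρ0.ne'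
    exact ⟨(a - b) * c, by rw [hc, pow_mul, hxd, zpow_mul, zpow_natCast]⟩
  classical
  have hex : ∃ k : ℕ, ∃ x : K, x ≠ 0 ∧ ‖x‖ < 1 ∧ ‖x‖ ^ n.factorial = ‖φ p‖ ^ k :=
    ⟨n.factorial, φ p, norm_pos_iff.1 hρ0, hρ1, rfl⟩
  obtain ⟨π, hπ0, hπ1, hπ⟩ := Nat.find_spec hex
  refine ⟨π, hπ0, hπ1, fun x hx1 ↦ ?_⟩
  by_cases hx : x = 0
  · simp [hx]
  obtain ⟨k, hk⟩ := key x hx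
  have hk0 : 0 ≤ k := by
    by_contra! hneg
    have h1 : ‖x‖ ^ n.factorial < 1 := pow_lt_one₀ (norm_nonneg _) hx1 hN
    rw [hk] at h1
    exact absurd h1 (not_lt.2 (one_le_zpow_of_nonpos₀ hρ0 hρ1.le hneg.le))
  lift k to ℕ using hk0
  rw [zpow_natCast] at hk
  have hle := Nat.find_min' hex ⟨x, hx, hx1, hk⟩
  rw [← pow_le_pow_iff_left₀ (norm_nonneg _) (norm_nonneg _) hN, hk, hπ]
  exact pow_le_pow_of_le_one hρ0.le hρ1.le hle

/-- Every residue class is a root of a nonzero polynomial of degree at most `n` over the finite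
image of `A` in the residue field. -/
theorem finite_ballResidueField [IsUltrametricDist K] (h : IsBoundedBase φ n) (hK : ∃ x : K, x ≠ 0 ∧ ‖x‖ ≠ 1)
    (hA : ∀ I : Ideal A, I ≠ ⊥ → Finite (A ⧸ I)) : Finite (ballResidueField K) := by
  classical
  obtain ⟨p, hp0, hp⟩ := h.exists_generator hK
  have hφp : φ p ≠ 0 := (map_ne_zero_iff φ h.injective).2 hp0
  let φ' : A →+* unitBall K := φ.codRestrict (unitBall K).toSubring
    fun a ↦ mem_unitBall.2 (h.norm_le_one a)
  let ψ : A →+* ballResidueField K := red.comp φ'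
  have hψ : ∀ a, ψ a = 0 ↔ p ∣ a := fun a ↦ red_eq_zero_iff.trans (hp a)
  have hker : RingHom.ker ψ ≠ ⊥ := by
    intro hbot
    have : p ∈ RingHom.ker ψ := (hψ p).2 dvd_rfl
    rw [hbot] at this
    exact hp0 this
  have hfin := hA _ hker
  have hrange : (Set.range ψ).Finite := by
    have : Finite ψ.range := Finite.of_equiv _ ψ.quotientKerEquivRange.toEquiv
    have h' : (ψ.range : Set (ballResidueField K)).Finite := Set.toFinite _
    rwa [RingHom.coe_range] at h'
  have hroots := bUnion_roots_finite (RingHom.id (ballResidueField K)) n hrange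
  rw [← Set.finite_univ_iff]
  refine hroots.subset fun y _ ↦ ?_
  obtain ⟨x, rfl⟩ := red_surjective y
  obtain ⟨Q, hQ, hQn, hQx⟩ := h.exists_polynomial x
  -- remove the content at `p`
  obtain ⟨m, R, hR, rfl⟩ := WfDvdMonoid.max_power_factor' hQ
    (show ¬ IsUnit (C p) by rw [isUnit_C]; exact not_isUnit_generator hp)
  have hRx : R.eval₂ φ x = 0 := by
    rw [eval₂_mul, eval₂_pow, eval₂_C] at hQx
    exact (mul_eq_zero.1 hQx).resolve_left (pow_ne_zero _ hφp)
  have hRn : R.natDegree ≤ n := by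
    rw [natDegree_mul (left_ne_zero_of_mul hQ) (right_ne_zero_of_mul hQ)] at hQn
    omega
  have hRψ : R.map ψ ≠ 0 := by
    intro h0
    refine hR ((C_dvd_iff_dvd_coeff _ _).2 fun i ↦ (hψ _).1 ?_)
    rw [← coeff_map, h0, coeff_zero]
  have heval : (R.map ψ).eval (red x) = 0 := by
    have h₁ : R.eval₂ φ' x = 0 := by
      have hinj : Function.Injective (unitBall K).subtype := Subtype.val_injective
      refine hinj ?_
      rw [hom_eval₂, map_zero]
      exact hRx
    rw [eval_map, ← hom_eval₂, h₁, map_zero]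
  simp only [Set.mem_iUnion]
  refine ⟨R.map ψ, ⟨natDegree_map_le.trans hRn, fun i ↦ ⟨R.coeff i, (coeff_map _ _).symm⟩⟩, ?_⟩
  rw [map_id, Finset.mem_coe, Multiset.mem_toFinset, mem_roots hRψ]
  exact heval

end IsBoundedBase

end Discrete

/-! ### Passage to the completion -/

section Completion

variable {K : Type*} [NormedField K]

theorem exists_coe_norm_sub_lt (x : UniformSpace.Completion K) {r : ℝ} (hr : 0 < r) :
    ∃ y : K, ‖x - y‖ < r := by
  obtain ⟨y, hy⟩ := UniformSpace.Completion.denseRange_coe.exists_dist_lt x hr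
  exact ⟨y, by rwa [dist_eq_norm] at hy⟩

variable [IsUltrametricDist K]

instance isUltrametricDist_completion : IsUltrametricDist (UniformSpace.Completion K) := by
  refine IsUltrametricDist.isUltrametricDist_of_forall_norm_add_le_max_norm fun x y ↦ ?_
  induction x, y using UniformSpace.Completion.induction_on₂ with
  | hp => exact isClosed_le (by fun_prop) (by fun_prop)
  | ih x y =>
    rw [← UniformSpace.Completion.coe_add, UniformSpace.Completion.norm_coe,
      UniformSpace.Completion.norm_coe, UniformSpace.Completion.norm_coe]
    exact IsUltrametricDist.norm_add_le_max x y

theorem norm_eq_of_norm_sub_lt {F : Type*} [NormedField F] [IsUltrametricDist F] {x y : F}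
    (h : ‖x - y‖ < ‖x‖) : ‖y‖ = ‖x‖ := by
  have hle : ‖y‖ ≤ ‖x‖ := by
    have := IsUltrametricDist.norm_add_le_max x (-(x - y))
    rw [norm_neg, max_eq_left h.le, show x + -(x - y) = y by ring] at this
    exact this
  refine le_antisymm hle ?_
  have := IsUltrametricDist.norm_add_le_max (x - y) y
  rw [sub_add_cancel] at this
  rcases le_max_iff.1 this with h' | h'
  · exact absurd h (not_lt.2 h')
  · exact h'

theorem IsNormUniformizer.completion {π : K} (hπ : IsNormUniformizer π) :
    IsNormUniformizer (π : UniformSpace.Completion K) where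
  ne_zero := by
    rw [← norm_ne_zero_iff, UniformSpace.Completion.norm_coe]
    exact norm_ne_zero_iff.2 hπ.ne_zero
  norm_lt_one := by
    rw [UniformSpace.Completion.norm_coe]
    exact hπ.norm_lt_one
  norm_le x hx := by
    by_cases hx0 : x = 0
    · simp [hx0]
    obtain ⟨y, hy⟩ := exists_coe_norm_sub_lt x (norm_pos_iff.2 hx0)
    have := norm_eq_of_norm_sub_lt hy
    rw [UniformSpace.Completion.norm_coe] at this ⊢
    rw [← this] at hx ⊢
    exact hπ.norm_le y hx

theorem finite_ballResidueField_completion [Finite (ballResidueField K)] :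
    Finite (ballResidueField (UniformSpace.Completion K)) := by
  have hlift : ∀ y : ballResidueField (UniformSpace.Completion K), ∃ x : unitBall K,
      y = red ⟨((x : K) : UniformSpace.Completion K),
        mem_unitBall.2 (by rw [UniformSpace.Completion.norm_coe]; exact x.2)⟩ := by
    intro y
    obtain ⟨z, rfl⟩ := red_surjective y
    obtain ⟨x, hx⟩ := exists_coe_norm_sub_lt (z : UniformSpace.Completion K) one_pos
    have hx1 : ‖x‖ ≤ 1 := by
      have := IsUltrametricDist.norm_add_le_max (z : UniformSpace.Completion K) (-(z - x))
      rw [show (z : UniformSpace.Completion K) + -(z - x) = x by ring, norm_neg,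
        UniformSpace.Completion.norm_coe] at this
      exact this.trans (max_le z.2 hx.le)
    refine ⟨⟨x, hx1⟩, ?_⟩
    rw [← sub_eq_zero, ← map_sub, red_eq_zero_iff]
    exact hx
  choose g hg using hlift
  refine Finite.of_injective (fun y ↦ red (g y)) fun y z hyz ↦ ?_
  rw [hg y, hg z, ← sub_eq_zero, ← map_sub, red_eq_zero_iff]
  rw [← sub_eq_zero, ← map_sub, red_eq_zero_iff] at hyz
  change ‖((g y : K) : UniformSpace.Completion K) - ((g z : K) : UniformSpace.Completion K)‖ < 1
  rw [← UniformSpace.Completion.coe_sub, UniformSpace.Completion.norm_coe]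
  exact hyz

end Completion

/-! ### Global fields -/

section GlobalField

open Polynomial

/-- Elements of a finite extension of the fraction field of `A` are algebraic over `A`, of degree
bounded by that of the extension. -/
theorem exists_polynomial_of_finiteDimensional {A K₀ K : Type*} [CommRing A] [IsDomain A] [Field K₀]
    [Algebra A K₀] [IsFractionRing A K₀] [Field K] [Algebra K₀ K] [FiniteDimensional K₀ K] (x : K) :
    ∃ P : A[X], P ≠ 0 ∧ P.natDegree ≤ Module.finrank K₀ K ∧
      P.eval₂ ((algebraMap K₀ K).comp (algebraMap A K₀)) x = 0 := by
  have hint : IsIntegral K₀ x := .of_finite K₀ x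
  refine ⟨IsLocalization.integerNormalization (nonZeroDivisors A) (minpoly K₀ x), ?_, ?_, ?_⟩
  · rw [ne_eq, IsFractionRing.integerNormalization_eq_zero_iff]
    exact minpoly.ne_zero hint
  · exact (natDegree_le_natDegree (degree_mono (IsLocalization.integerNormalization_support _ _))).trans
      (minpoly.natDegree_le x)
  · exact IsLocalization.integerNormalization_eval₂_eq_zero _ _ _ (minpoly.aeval K₀ x)

theorem norm_eval₂_le_one {k L : Type*} [Semiring k] [NormedField L] [IsUltrametricDist L]
    (i : k →+* L) (hi : ∀ c, ‖i c‖ ≤ 1) {t : L} (ht : ‖t‖ ≤ 1) (f : k[X]) :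
    ‖f.eval₂ i t‖ ≤ 1 := by
  rw [eval₂_eq_sum, sum_def]
  refine IsUltrametricDist.norm_sum_le_of_forall_le_of_nonneg zero_le_one fun n _ ↦ ?_
  rw [norm_mul, norm_pow]
  exact mul_le_one₀ (hi _) (by positivity) (pow_le_one₀ (norm_nonneg _) ht)

/-- Replacing the variable by its inverse turns polynomial relations over `k[t]` into relations
over `k[t⁻¹]`. -/
theorem exists_polynomial_inv {k L : Type*} [Field k] [Field L] {i : k →+* L} {t : L} (ht : t ≠ 0)
    {P : k[X][X]} (hP : P ≠ 0) {x : L} (h : P.eval₂ (eval₂RingHom i t) x = 0) :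
    ∃ Q : k[X][X], Q ≠ 0 ∧ Q.natDegree ≤ P.natDegree ∧ Q.eval₂ (eval₂RingHom i t⁻¹) x = 0 := by
  let _ : Invertible t := invertibleOfNonzero ht
  let N := P.support.sup fun j ↦ (P.coeff j).natDegree
  have hN : ∀ j, (P.coeff j).natDegree ≤ N := by
    intro j
    by_cases hj : P.coeff j = 0
    · simp [hj]
    · exact Finset.le_sup (f := fun j ↦ (P.coeff j).natDegree) (mem_support_iff.2 hj)
  let Q : k[X][X] := ∑ j ∈ P.support, monomial j (reflect N (P.coeff j))
  have hQ : ∀ j, Q.coeff j = reflect N (P.coeff j) := by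
    intro j
    simp only [Q, finsetSum_coeff, coeff_monomial, Finset.sum_ite_eq', mem_support_iff]
    split_ifs with hj
    · rfl
    · rw [notMem_support_iff.1 hj, reflect_zero]
  refine ⟨Q, ?_, ?_, ?_⟩
  · obtain ⟨j, hj⟩ := support_nonempty.2 hP
    intro h0
    have := hQ j
    rw [h0, coeff_zero, eq_comm, reflect_eq_zero_iff] at this
    exact mem_support_iff.1 hj this
  · refine natDegree_le_iff_coeff_eq_zero.2 fun j hj ↦ ?_
    rw [hQ, coeff_eq_zero_of_natDegree_lt hj, reflect_zero]
  · have hsum : Q.eval₂ (eval₂RingHom i t⁻¹) x * t ^ N = P.eval₂ (eval₂RingHom i t) x := by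
      rw [eval₂_finsetSum, Finset.sum_mul, eval₂_eq_sum, sum_def]
      refine Finset.sum_congr rfl fun j _ ↦ ?_
      rw [eval₂_monomial, coe_eval₂RingHom, coe_eval₂RingHom,
        ← eval₂_reflect_mul_pow i t N _ (hN j), invOf_eq_inv]
      ring
    rw [h] at hsum
    exact (mul_eq_zero.1 hsum).resolve_right (pow_ne_zero _ ht)

theorem finite_quotient_polynomial (k : Type*) [Field k] [Finite k] (I : Ideal k[X])
    (hI : I ≠ ⊥) : Finite (k[X] ⧸ I) := by
  obtain ⟨f, hf, hf0⟩ := Submodule.exists_mem_ne_zero_of_ne_bot hI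
  have hmonic : (f * C f.leadingCoeff⁻¹).Monic := monic_mul_leadingCoeff_inv hf0
  have := hmonic.finite_quotient
  have : Finite (k[X] ⧸ Ideal.span {f * C f.leadingCoeff⁻¹}) := Module.finite_of_finite k
  refine Finite.of_surjective _ (Ideal.Quotient.factor_surjective
    (show Ideal.span {f * C f.leadingCoeff⁻¹} ≤ I from ?_))
  rw [Ideal.span_singleton_le_iff_mem]
  exact I.mul_mem_right _ hf

variable {K L : Type*} [Field K] [NormedField L] [IsUltrametricDist L]

/-- Here the base ring is `ℤ`. -/
theorem discrete_of_numberField [NumberField K] (e : K ≃+* L) (hL : ∃ x : L, x ≠ 0 ∧ ‖x‖ ≠ 1) :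
    (∃ π : L, IsNormUniformizer π) ∧ Finite (ballResidueField L) := by
  have : CharZero L := (RingHom.charZero_iff (ϕ := (e : K →+* L)) e.injective).1 inferInstance
  have hbase : IsBoundedBase (Int.castRingHom L) (Module.finrank ℚ K) := by
    refine ⟨(Int.castRingHom L).injective_int, fun a ↦ ?_, fun x ↦ ?_⟩
    · exact IsUltrametricDist.norm_intCast_le_one L a
    · obtain ⟨P, hP, hdeg, h⟩ := exists_polynomial_of_finiteDimensional (A := ℤ) (K₀ := ℚ) (e.symm x)
      refine ⟨P, hP, hdeg, ?_⟩
      have := congrArg e h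
      rw [map_zero, ← RingEquiv.coe_toRingHom, hom_eval₂] at this
      rw [← this]
      congr 1
      · exact RingHom.ext_int _ _
      · simp
  exact ⟨hbase.exists_isNormUniformizer hL, hbase.finite_ballResidueField hL
    fun I hI ↦ Ring.HasFiniteQuotients.finiteQuotient hI⟩

/-- Here the base ring is `𝔽_p[t]` or `𝔽_p[t⁻¹]`, whichever lies in the unit ball. -/
theorem discrete_of_functionField {p : ℕ} [Fact p.Prime] [Algebra (RatFunc (ZMod p)) K]
    [FunctionField (ZMod p) K] (e : K ≃+* L) (hL : ∃ x : L, x ≠ 0 ∧ ‖x‖ ≠ 1) :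
    (∃ π : L, IsNormUniformizer π) ∧ Finite (ballResidueField L) := by
  let φ : (ZMod p)[X] →+* L := (e : K →+* L).comp
    ((algebraMap (RatFunc (ZMod p)) K).comp (algebraMap (ZMod p)[X] (RatFunc (ZMod p))))
  have hφ : Function.Injective φ := e.injective.comp
    ((algebraMap (RatFunc (ZMod p)) K).injective.comp (IsFractionRing.injective _ _))
  let i : ZMod p →+* L := φ.comp C
  have hi : ∀ c, ‖i c‖ ≤ 1 := fun c ↦ by
    obtain ⟨m, rfl⟩ := ZMod.natCast_zmod_surjective c
    rw [map_natCast]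
    exact norm_natCast_le m
  have hφi : eval₂RingHom i (φ X) = φ := by
    ext <;> simp [i]
  have hpoly : ∀ x : L, ∃ P : (ZMod p)[X][X], P ≠ 0 ∧
      P.natDegree ≤ Module.finrank (RatFunc (ZMod p)) K ∧ P.eval₂ φ x = 0 := fun x ↦ by
    obtain ⟨P, hP, hdeg, h⟩ := exists_polynomial_of_finiteDimensional (A := (ZMod p)[X])
      (K₀ := RatFunc (ZMod p)) (e.symm x)
    refine ⟨P, hP, hdeg, ?_⟩
    have := congrArg e h
    rw [map_zero, ← RingEquiv.coe_toRingHom, hom_eval₂] at this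
    simpa using this
  have ht : φ X ≠ 0 := (map_ne_zero_iff φ hφ).2 X_ne_zero
  -- one of `t` and `t⁻¹` is integral
  obtain ⟨s, hs⟩ : ∃ s : L, IsBoundedBase (eval₂RingHom i s)
      (Module.finrank (RatFunc (ZMod p)) K) := by
    rcases le_total ‖φ X‖ 1 with hle | hle
    · exact ⟨φ X, by rwa [hφi], fun f ↦ norm_eval₂_le_one i hi hle f, by rwa [hφi]⟩
    · refine ⟨(φ X)⁻¹, ?_, fun f ↦ norm_eval₂_le_one i hi ?_ f, fun x ↦ ?_⟩
      · rw [injective_iff_map_eq_zero]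
        intro f hf
        let _ : Invertible (φ X) := invertibleOfNonzero ht
        have h := (eval₂_reflect_eq_zero_iff i (φ X) f.natDegree (reflect f.natDegree f)
          (natDegree_reflect_le.trans (max_self _).le)).1 (by rw [reflect_reflect, invOf_eq_inv]; exact hf)
        have h' : φ (reflect f.natDegree f) = 0 := by rw [← hφi]; exact h
        rwa [map_eq_zero_iff φ hφ, reflect_eq_zero_iff] at h'
      · rw [norm_inv]
        exact inv_le_one_of_one_le₀ hle
      · obtain ⟨P, hP, hdeg, h⟩ := hpoly x
        rw [← hφi] at h
        obtain ⟨Q, hQ, hQdeg, hQx⟩ := exists_polynomial_inv ht hP h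
        exact ⟨Q, hQ, hQdeg.trans hdeg, hQx⟩
  exact ⟨hs.exists_isNormUniformizer hL, hs.finite_ballResidueField hL
    (finite_quotient_polynomial (ZMod p))⟩

end GlobalField

/-- `w` is an absolute value representing a non-archimedean place of the global field `K`, and
`w.Completion` is `K_w`. -/
theorem theorem2p3 {K : Type*} [Field K] (hK : IsGlobalField K) (hchar : ringChar K ≠ 2)
    (w : AbsoluteValue K ℝ) (hw : w.IsNontrivial) (hna : IsNonarchimedean w)
    (a₁ a₂ a₃ a₄ : (w.Completion)ˣ) :
    IsIsotropic (quaternaryForm a₁ a₂ a₃ a₄) ↔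
      (squareClass (a₁ * a₂) ≠ squareClass (a₃ * a₄) ∨
        hilbertSymbol a₁ a₂ ≠ -hilbertSymbol (-a₃) (-a₄)) := by
  have : IsUltrametricDist (WithAbs w) :=
    IsUltrametricDist.isUltrametricDist_of_isNonarchimedean_norm fun x y ↦ hna x.ofAbs y.ofAbs
  have hL : ∃ x : WithAbs w, x ≠ 0 ∧ ‖x‖ ≠ 1 := by
    obtain ⟨x, hx, hx1⟩ := hw
    exact ⟨WithAbs.toAbs w x, by simpa using hx, hx1⟩
  obtain ⟨⟨π, hπ⟩, hfin⟩ : (∃ π : WithAbs w, IsNormUniformizer π) ∧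
      Finite (ballResidueField (WithAbs w)) := by
    rcases hK with hK | ⟨p, hp, halg, hK⟩
    · exact discrete_of_numberField (WithAbs.equiv w).symm hL
    · exact discrete_of_functionField (p := p) (WithAbs.equiv w).symm hL
  have hfin' : Finite (ballResidueField w.Completion) := finite_ballResidueField_completion
  have h2 : (2 : w.Completion) ≠ 0 := by
    have h2K : (2 : WithAbs w) ≠ 0 := by
      intro h
      exact Ring.two_ne_zero hchar (congrArg WithAbs.ofAbs h)
    rw [← norm_ne_zero_iff]
    have : (2 : w.Completion) = ((2 : WithAbs w) : w.Completion) :=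
      (map_ofNat (UniformSpace.Completion.coeRingHom (α := WithAbs w)) 2).symm
    rw [this, UniformSpace.Completion.norm_coe]
    exact norm_ne_zero_iff.2 h2K
  have hF := quaternaryFormsIsotropic_of_isNormUniformizer h2 hπ.completion
  obtain ⟨d, hd, hsq, hidx⟩ := exists_nonsquare_normIndexLeTwo h2 hπ.completion
  exact isIsotropic_quaternaryForm_iff_of_norm_index h2 hF
    (fun e he ↦ normIndexLeTwo_of_one h2 hF hd hsq hidx he) a₁ a₂ a₃ a₄
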